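/- Let $N\in\mathbb Z\setminus\{0\}$ and let $(e_i)_{i\in I}$ be an orthonormal family (for instance an orthonormal basis) in a complex Hilbert space $H$. *Fock space.* For $\sigma\in S_n$ let $c(\sigma)$ be the number of cycles of $\sigma$ (fixed points included) and $\phi_N(\sigma)=N^{-(n-c(\sigma))}$. Let $\mathcal F_N(H)$ be the Hilbert space obtained from the linear combinations of simple tensors over $H$ (with vacuum vector $\Omega$ in degree $0$) and the semi-inner product $$\langle \xi_1\otimes\cdots\otimes\xi_m,\eta_1\otimes\cdots\otimes\eta_n\rangle_N=\delta_{mn}\sum_{\sigma\in S_n}\phi_N(\sigma)\prod_{k=1}^n\langle\xi_k,\eta_{\sigma^{-1}(k)}\rangle$$ by dividing out the kernel and completing. On the image of the linear combinations of simple tensors let $L_i\,\xi_1\otimes\cdots\otimes\xi_n=e_i\otimes\xi_1\otimes\cdots\otimes\xi_n$, $L_i^*\Omega=0$ and $$L_i^*\,\xi_1\otimes\cdots\otimes\xi_n=\langle e_i,\xi_1\rangle\,\xi_2\otimes\cdots\otimes\xi_n+\frac1N\sum_{k=2}^n\langle e_i,\xi_k\rangle\,\xi_2\otimes\cdots\otimes\xi_{k-1}\otimes\xi_1\otimes\xi_{k+1}\otimes\cdots\otimes\xi_n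 ,$$ and let $\rho(T)=\langle\Omega,T\Omega\rangle_N$ be the vacuum expectation. *Words.* Let $n\ge0$ and let $W=L_{i_1}^{\varepsilon_1}L_{i_2}^{\varepsilon_2}\cdots L_{i_{2n}}^{\varepsilon_{2n}}$, $\varepsilon_j\in\{*,1\}$, be a multidimensional Dyck word: for every colour $i\in I$, every final segment $L_{i_k}^{\varepsilon_k}\cdots L_{i_{2n}}^{\varepsilon_{2n}}$ contains at least as many letters $L_i$ as letters $L_i^*$, and $W$ contains equally many of both. *Digraph.* Let $\hat\pi$ be the unique noncrossing pair partition of $\{1,\dots,2n\}$ whose left points are the positions $p$ with $\varepsilon_p=*$, and for such $p$ let $b(p)$ be the right point paired with $p$ by $\hat\pi$. The digraph $\Gamma$ has as vertices the $n$ positions $p$ with $\varepsilon_p=*$, and an arrow $p\to p'$ (loops allowed) if and only if $i_p=i_{b(p')}$ and $b(p')>p$. Its cycle cover polynomial is $C_c(\Gamma;x)=\sum_C x^{|C|}$, the sum over all covers $C$ of the vertex set by vertex-disjoint directed cycles (loops being cycles of length one), with $|C|$ the number of cycles. *Pair partitions.* For a pair partition $\pi$ let $|\pi|$ be its number of pairs,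 and let $c(\pi)$ be its number of cycles, where the pair $(l,r)$ is followed by the pair $(l',r')$ if $(l,r')$ belongs to the noncrossing pair partition with the same left points as $\pi$. Let $\mathbf t_N(\pi)=N^{-(|\pi|-c(\pi))}$, let $Q(*,1)=1$ and let $Q(\varepsilon,\varepsilon')=0$ otherwise. **Theorem.** The vacuum expectation of $W$ on $\mathcal F_N(H)$ is $$\rho(L_{i_1}^{\varepsilon_1}L_{i_2}^{\varepsilon_2}\cdots L_{i_{2n}}^{\varepsilon_{2n}})=\frac1{N^n}\,C_c(\Gamma;N),$$ and the Fock state given by $\mathbf t_N$ has the same value on $W$: $$\sum_{\pi}\mathbf t_N(\pi)\prod_{\{k<l\}\in\pi}Q(\varepsilon_k,\varepsilon_l)\,\langle e_{i_k},e_{i_l}\rangle=\frac1{N^n}\,C_c(\Gamma;N),$$ the sum running over all pair partitions $\pi$ of $\{1,\dots,2n\}$. -/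

import Mathlib

noncomputable section

namespace CharFock

section

open Equiv
open scoped ComplexOrder

/-- The number of cycles of a permutation, fixed points included. -/
def cycleCount {V : Type*} (σ : Perm V) : ℕ :=
  Nat.card (Quotient (Perm.SameCycle.setoid σ))

/-- The character `φ_N(σ) = (1/N) ^ (n - c(σ)) = ∏_{m ≥ 2} (1/N) ^ ((m - 1) c_m(σ))`. -/
def charN (N : ℤ) {n : ℕ} (σ : Perm (Fin n)) : ℂ :=
  (1 / (N : ℂ)) ^ ((n : ℤ) - (cycleCount σ : ℤ))

theorem card_invariant {V : Type*} [Finite V] (σ : Perm V) (M : ℕ) :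
    Nat.card {f : V → Fin M // ∀ x, f (σ x) = f x} = M ^ cycleCount σ := by
  have e : {f : V → Fin M // ∀ x, f (σ x) = f x} ≃
      (Quotient (Perm.SameCycle.setoid σ) → Fin M) :=
    { toFun := fun f => Quotient.lift f.1 (by
        intro a b hab
        obtain ⟨k, hk⟩ : σ.SameCycle a b := hab
        have hz : ∀ (k : ℤ) (x : V), f.1 ((σ ^ k) x) = f.1 x := by
          intro k
          induction k with
          | zero => intro x; simp
          | succ i ih => intro x; rw [zpow_add_one, Perm.mul_apply, ih, f.2]
          | pred i ih =>
            intro x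
            rw [zpow_sub_one, Perm.mul_apply, ih, ← f.2 (σ⁻¹ x)]
            simp
        rw [← hk, hz])
      invFun := fun g => ⟨fun x => g (Quotient.mk _ x), fun x => by
        refine congrArg g (Quotient.sound ?_)
        exact (Perm.sameCycle_apply_left.2 (Perm.SameCycle.refl σ x))⟩
      left_inv := fun f => rfl
      right_inv := fun g => by
        funext q
        induction q using Quotient.inductionOn with
        | h x => rfl }
  rw [Nat.card_congr e, Nat.card_fun, Nat.card_fin, cycleCount]

theorem cycleCount_decompose_zero {n : ℕ} (e : Perm (Fin n)) :
    cycleCount (Perm.decomposeFin.symm (0, e)) = cycleCount e + 1 := by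
  have key : Nat.card {f : Fin (n + 1) → Fin 2 //
      ∀ x, f (Perm.decomposeFin.symm (0, e) x) = f x} =
      Nat.card (Fin 2 × {f : Fin n → Fin 2 // ∀ x, f (e x) = f x}) := by
    refine Nat.card_congr
      { toFun := fun f => (f.1 0, ⟨fun x => f.1 x.succ, fun x => ?_⟩)
        invFun := fun g => ⟨Fin.cons g.1 g.2.1, fun x => ?_⟩
        left_inv := fun f => ?_
        right_inv := fun g => ?_ }
    · have := f.2 x.succ
      simpa using this
    · refine Fin.cases ?_ (fun y => ?_) x
      · simp
      · simpa using g.2.2 y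
    · ext x
      refine Fin.cases ?_ (fun y => ?_) x <;> simp
    · ext <;> simp
  rw [card_invariant, Nat.card_prod, card_invariant, Nat.card_fin] at key
  apply Nat.pow_right_injective (le_refl 2)
  simp only
  rw [key, pow_succ, mul_comm]

theorem cycleCount_decompose_succ {n : ℕ} (p : Fin n) (e : Perm (Fin n)) :
    cycleCount (Perm.decomposeFin.symm (p.succ, e)) = cycleCount e := by
  have key : Nat.card {f : Fin (n + 1) → Fin 2 //
      ∀ x, f (Perm.decomposeFin.symm (p.succ, e) x) = f x} =
      Nat.card {f : Fin n → Fin 2 // ∀ x, f (e x) = f x} := by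
    refine Nat.card_congr
      { toFun := fun f => ⟨fun x => f.1 x.succ, fun x => ?_⟩
        invFun := fun g => ⟨Fin.cons (g.1 p) g.1, fun x => ?_⟩
        left_inv := fun f => ?_
        right_inv := fun g => ?_ }
    · have h0 := f.2 0
      have h1 := f.2 x.succ
      simp only [Perm.decomposeFin_symm_apply_zero] at h0
      simp only [Perm.decomposeFin_symm_apply_succ, swap_apply_def, Fin.succ_ne_zero,
        if_false, Fin.succ_inj] at h1
      split_ifs at h1 with hx
      · simp only [hx, h0, h1]
      · exact h1
    · refine Fin.cases ?_ (fun y => ?_) x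
      · simp
      · have := g.2 y
        simp only [Perm.decomposeFin_symm_apply_succ, swap_apply_def, Fin.succ_ne_zero,
          if_false, Fin.succ_inj]
        split_ifs with hx
        · simpa [hx] using this
        · simpa using this
    · have h0 := f.2 0
      ext x
      refine Fin.cases ?_ (fun y => ?_) x
      · simpa using congrArg Fin.val h0
      · simp
    · ext; simp
  rw [card_invariant, card_invariant] at key
  exact Nat.pow_right_injective (le_refl 2) key

theorem charN_inv (N : ℤ) {n : ℕ} (σ : Perm (Fin n)) : charN N σ⁻¹ = charN N σ := by
  have h : Perm.SameCycle.setoid σ⁻¹ = Perm.SameCycle.setoid σ :=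
    Setoid.ext fun _ _ => Perm.sameCycle_inv
  unfold charN cycleCount
  rw [h]

theorem charN_decompose_zero (N : ℤ) {n : ℕ} (e : Perm (Fin n)) :
    charN N (Perm.decomposeFin.symm (0, e)) = charN N e := by
  unfold charN
  rw [cycleCount_decompose_zero]
  congr 1
  push_cast
  ring

theorem charN_decompose_succ (N : ℤ) [NeZero N] {n : ℕ} (p : Fin n) (e : Perm (Fin n)) :
    charN N (Perm.decomposeFin.symm (p.succ, e)) = 1 / (N : ℂ) * charN N e := by
  unfold charN
  have hN : (1 / (N : ℂ)) ≠ 0 := one_div_ne_zero (by exact_mod_cast NeZero.ne N)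
  rw [cycleCount_decompose_succ, ← zpow_one_add₀ hN]
  congr 1
  push_cast
  ring

/-- `χ` is trivial for `N > 0`, the signature for `N < 0`. -/
def signN (N : ℤ) {n : ℕ} (σ : Perm (Fin n)) : ℂ :=
  if 0 < N then 1 else ((Perm.sign σ : ℤ) : ℂ)

theorem signN_mul (N : ℤ) {n : ℕ} (σ τ : Perm (Fin n)) :
    signN N (σ * τ) = signN N σ * signN N τ := by
  unfold signN
  split_ifs <;> simp

theorem signN_inv (N : ℤ) {n : ℕ} (σ : Perm (Fin n)) : signN N σ⁻¹ = signN N σ := by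
  unfold signN
  split_ifs <;> simp

theorem charN_eq (N : ℤ) [NeZero N] {n : ℕ} (σ : Perm (Fin n)) :
    charN N σ * (N.natAbs : ℂ) ^ n = signN N σ * (N.natAbs : ℂ) ^ cycleCount σ := by
  have hN0 : N ≠ 0 := NeZero.ne N
  have hNC : (N : ℂ) ≠ 0 := by exact_mod_cast hN0
  induction n with
  | zero =>
    have hc : cycleCount σ = 0 := by
      have := card_invariant σ 2
      have h2 : Nat.card {f : Fin 0 → Fin 2 // ∀ x, f (σ x) = f x} = 1 := by
        rw [Nat.card_eq_one_iff_unique]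
        exact ⟨inferInstance, ⟨⟨fun x => x.elim0, fun x => x.elim0⟩⟩⟩
      rw [h2] at this
      by_contra h
      have := Nat.one_lt_two_pow h
      omega
    have hs : σ = 1 := Subsingleton.elim _ _
    simp only [charN, hc, signN]
    subst hs
    split_ifs <;> simp
  | succ n ih =>
    obtain ⟨⟨p, e⟩, rfl⟩ := Perm.decomposeFin.symm.surjective σ
    refine Fin.cases ?_ (fun p => ?_) p
    · rw [charN_decompose_zero, cycleCount_decompose_zero, pow_succ, pow_succ, ← mul_assoc, ih,
        ← mul_assoc]
      congr 2
      simp [signN]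
    · rw [charN_decompose_succ, cycleCount_decompose_succ, pow_succ]
      have : 1 / (N : ℂ) * charN N e * ((N.natAbs : ℂ) ^ n * (N.natAbs : ℂ)) =
        (1 / (N : ℂ) * (N.natAbs : ℂ)) * (charN N e * (N.natAbs : ℂ) ^ n) := by ring
      rw [this, ih, ← mul_assoc]
      congr 1
      unfold signN
      rcases lt_or_gt_of_ne hN0 with h | h
      · have h1 : (N.natAbs : ℂ) = -(N : ℂ) := by
          have : (N.natAbs : ℤ) = -N := by omega
          rw [← Int.cast_neg, ← this, Int.cast_natCast]
        rw [h1, if_neg (by omega), if_neg (by omega), Perm.decomposeFin.symm_sign,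
          if_neg (Fin.succ_ne_zero p)]
        field_simp
        simp
      · have h1 : (N.natAbs : ℂ) = (N : ℂ) := by
          have : (N.natAbs : ℤ) = N := by omega
          conv_rhs => rw [← this, Int.cast_natCast]
        rw [h1, if_pos h, if_pos h]
        field_simp

section Kernel
variable {H : Type*} [NormedAddCommGroup H] [InnerProductSpace ℂ H]

/-- The deformed inner product of two simple tensors of the same degree:
`⟨x₁ ⊗ ⋯ ⊗ xₙ, y₁ ⊗ ⋯ ⊗ yₙ⟩_N = ∑_σ φ_N(σ) ∏_k ⟨x_k, y_{σ⁻¹(k)}⟩`. -/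
def tensorForm (N : ℤ) {n : ℕ} (x y : Fin n → H) : ℂ :=
  ∑ σ : Perm (Fin n), charN N σ * ∏ k, inner ℂ (x k) (y (σ⁻¹ k))

theorem posSemidef_gram {X E : Type*} [NormedAddCommGroup E] [InnerProductSpace ℂ E]
    (v : X → E) : (Matrix.gram ℂ v).PosSemidef := by
  refine ⟨Matrix.isHermitian_gram ℂ v, fun c => ?_⟩
  have h : (c.sum fun i xi => c.sum fun j xj => star xi * Matrix.gram ℂ v i j * xj) =
      inner ℂ (∑ i ∈ c.support, c i • v i) (∑ i ∈ c.support, c i • v i) := by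
    simp only [Finsupp.sum, sum_inner, inner_sum, inner_smul_left, inner_smul_right,
      Matrix.gram_apply, Finset.mul_sum]
    rw [Finset.sum_comm]
    refine Finset.sum_congr rfl fun x _ => Finset.sum_congr rfl fun y _ => ?_
    simp only [starRingEnd_apply]
    ring
  rw [h, inner_self_eq_norm_sq_to_K]
  positivity

theorem posSemidef_prod {X κ : Type*} (s : Finset κ) (A : κ → Matrix X X ℂ)
    (hA : ∀ k, (A k).PosSemidef) :
    (Matrix.of fun x y => ∏ k ∈ s, A k x y : Matrix X X ℂ).PosSemidef := by
  classical
  induction s using Finset.induction_on with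
  | empty =>
    have := posSemidef_gram (fun _ : X => (1 : ℂ))
    convert this using 1
    ext x y
    simp [Matrix.gram]
  | insert a s ha ih =>
    have := (hA a).hadamard ih
    have h2 : (Matrix.of fun x y => ∏ k ∈ insert a s, A k x y : Matrix X X ℂ) =
        (A a).hadamard (Matrix.of fun x y => ∏ k ∈ s, A k x y) := by
      ext x y
      simp [Finset.prod_insert ha]
    rw [h2]
    exact this

theorem posSemidef_sum_index {P X : Type*} [Fintype P] (T : Matrix (P × X) (P × X) ℂ)
    (hT : T.PosSemidef) :
    (Matrix.of fun x y => ∑ σ, ∑ τ, T (σ, x) (τ, y) : Matrix X X ℂ).PosSemidef := by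
  classical
  refine ⟨?_, fun c => ?_⟩
  · ext x y
    simp only [Matrix.conjTranspose_apply, Matrix.of_apply, star_sum]
    rw [Finset.sum_comm]
    refine Finset.sum_congr rfl fun σ _ => Finset.sum_congr rfl fun τ _ => ?_
    exact hT.1.apply _ _
  · let d : (P × X) →₀ ℂ := Finsupp.onFinset (Finset.univ ×ˢ c.support) (fun q => c q.2)
      (by intro q hq; simpa using hq)
    have h := hT.2 d
    have e : ∀ g : P × X → ℂ → ℂ, (∀ q, g q 0 = 0) →
        d.sum g = ∑ σ, c.sum fun x a => g (σ, x) a := by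
      intro g hg
      rw [Finsupp.onFinset_sum _ hg, Finset.sum_product]
      rfl
    rw [e _ (by intro q; simp [Finsupp.sum])] at h
    have e2 : ∀ (q : P × X) (a : ℂ), (d.sum fun j xj => star a * T q j * xj) =
        ∑ τ, c.sum fun y b => star a * T q (τ, y) * b := by
      intro q a
      rw [e _ (by intro q; simp)]
    simp only [e2] at h
    convert h using 1
    simp only [Finsupp.sum, Matrix.of_apply, Finset.mul_sum, Finset.sum_mul]
    calc _ = ∑ x ∈ c.support, ∑ σ, ∑ τ, ∑ y ∈ c.support,
            star (c x) * T (σ, x) (τ, y) * c y := by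
          refine Finset.sum_congr rfl fun x _ => ?_
          rw [Finset.sum_comm]
          refine Finset.sum_congr rfl fun σ _ => ?_
          rw [Finset.sum_comm]
      _ = _ := Finset.sum_comm

theorem tensorForm_eq (N : ℤ) [NeZero N] {n : ℕ} (x y : Fin n → H) :
    ((n.factorial : ℂ) * (N.natAbs : ℂ) ^ n) * tensorForm N x y =
      ∑ f : Fin n → Fin N.natAbs, ∑ σ : Perm (Fin n), ∑ τ : Perm (Fin n),
        (inner ℂ (signN N σ) (signN N τ)) *
          (∏ k, inner ℂ (EuclideanSpace.single (f (σ k)) (1 : ℂ))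
            (EuclideanSpace.single (f (τ k)) (1 : ℂ))) *
          ∏ k, inner ℂ (x (σ k)) (y (τ k)) := by
  have h1 : ∀ σ τ : Perm (Fin n),
      (inner ℂ (signN N σ) (signN N τ) : ℂ) = signN N (τ * σ⁻¹) := by
    intro σ τ
    rw [signN_mul, signN_inv]
    unfold signN
    split_ifs <;> simp
  have h2 : ∀ ρ : Perm (Fin n), ∑ f : Fin n → Fin N.natAbs,
      (∏ k, inner ℂ (EuclideanSpace.single (f k) (1 : ℂ))
            (EuclideanSpace.single (f (ρ k)) (1 : ℂ)) : ℂ) = (N.natAbs : ℂ) ^ cycleCount ρ := by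
    intro ρ
    have h := card_invariant ρ N.natAbs
    rw [Nat.card_eq_fintype_card, Fintype.card_subtype] at h
    rw [← Nat.cast_pow, ← h, Finset.card_filter, Nat.cast_sum]
    refine Finset.sum_congr rfl fun f _ => ?_
    simp only [EuclideanSpace.inner_single_left, PiLp.single_apply]
    rw [Finset.prod_congr rfl (g := fun k => if f (ρ k) = f k then (1 : ℂ) else 0)
      (by intro k _; simp [eq_comm]), Finset.prod_ite_zero]
    simp
  have h3 : ∀ (f : Fin n → Fin N.natAbs) (σ τ : Perm (Fin n)),
        (inner ℂ (signN N σ) (signN N τ) : ℂ) *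
          (∏ k, inner ℂ (EuclideanSpace.single (f (σ k)) (1 : ℂ))
            (EuclideanSpace.single (f (τ k)) (1 : ℂ))) *
          ∏ k, inner ℂ (x (σ k)) (y (τ k)) =
        signN N (τ * σ⁻¹) *
          (∏ k, inner ℂ (EuclideanSpace.single (f k) (1 : ℂ))
            (EuclideanSpace.single (f ((τ * σ⁻¹) k)) (1 : ℂ))) *
          ∏ k, inner ℂ (x k) (y ((τ * σ⁻¹) k)) := by
    intro f σ τ
    rw [h1]
    congr 1
    · congr 1
      rw [← Equiv.prod_comp σ (fun k => (inner ℂ (EuclideanSpace.single (f k) (1 : ℂ))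
        (EuclideanSpace.single (f ((τ * σ⁻¹) k)) (1 : ℂ)) : ℂ))]
      simp
    · rw [← Equiv.prod_comp σ (fun k => (inner ℂ (x k) (y ((τ * σ⁻¹) k)) : ℂ))]
      simp
  simp only [h3]
  have h4 : ∀ (f : Fin n → Fin N.natAbs) (σ : Perm (Fin n)),
      (∑ τ : Perm (Fin n), signN N (τ * σ⁻¹) *
          (∏ k, inner ℂ (EuclideanSpace.single (f k) (1 : ℂ))
            (EuclideanSpace.single (f ((τ * σ⁻¹) k)) (1 : ℂ))) *
          ∏ k, inner ℂ (x k) (y ((τ * σ⁻¹) k)) : ℂ) =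
      ∑ ρ : Perm (Fin n), signN N ρ *
          (∏ k, inner ℂ (EuclideanSpace.single (f k) (1 : ℂ))
            (EuclideanSpace.single (f (ρ k)) (1 : ℂ))) *
          ∏ k, inner ℂ (x k) (y (ρ k)) := by
    intro f σ
    exact Equiv.sum_comp (Equiv.mulRight σ⁻¹) (fun ρ : Perm (Fin n) => signN N ρ *
          (∏ k, (inner ℂ (EuclideanSpace.single (f k) (1 : ℂ))
            (EuclideanSpace.single (f (ρ k)) (1 : ℂ)) : ℂ)) *
          ∏ k, inner ℂ (x k) (y (ρ k)))
  simp only [h4, Finset.sum_const, Finset.card_univ, Fintype.card_perm, Fintype.card_fin,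
    nsmul_eq_mul]
  rw [← Finset.mul_sum, Finset.sum_comm, mul_assoc]
  congr 1
  unfold tensorForm
  rw [← Equiv.sum_comp (Equiv.inv (Perm (Fin n))), Finset.mul_sum]
  refine Finset.sum_congr rfl fun ρ _ => ?_
  rw [← Finset.sum_mul, ← Finset.mul_sum, h2, ← charN_eq]
  simp only [Equiv.inv_apply, inv_inv, charN_inv]
  ring

theorem posSemidef_tensorForm (N : ℤ) [NeZero N] (n : ℕ) :
    (Matrix.of fun x y : Fin n → H => tensorForm N x y).PosSemidef := by
  have hc : ((n.factorial : ℂ) * (N.natAbs : ℂ) ^ n) ≠ 0 := by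
    have : (N.natAbs : ℂ) ≠ 0 := by
      exact_mod_cast Int.natAbs_ne_zero.2 (NeZero.ne N)
    positivity
  have e : (Matrix.of fun x y : Fin n → H => tensorForm N x y) =
      ((n.factorial : ℂ) * (N.natAbs : ℂ) ^ n)⁻¹ • ∑ f : Fin n → Fin N.natAbs,
        (Matrix.of fun x y => ∑ σ : Perm (Fin n), ∑ τ : Perm (Fin n),
          ((Matrix.gram ℂ (fun q : Perm (Fin n) × (Fin n → H) => signN N q.1)).hadamard
            ((Matrix.of fun p q => ∏ k : Fin n,
              Matrix.gram ℂ (fun q : Perm (Fin n) × (Fin n → H) =>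
                EuclideanSpace.single (f (q.1 k)) (1 : ℂ)) p q).hadamard
            (Matrix.of fun p q => ∏ k : Fin n,
              Matrix.gram ℂ (fun q : Perm (Fin n) × (Fin n → H) => q.2 (q.1 k)) p q)))
            (σ, x) (τ, y)) := by
    ext x y
    rw [Matrix.of_apply, Matrix.smul_apply, smul_eq_mul, eq_inv_mul_iff_mul_eq₀ hc, tensorForm_eq,
      Matrix.sum_apply]
    simp only [Matrix.of_apply, Matrix.hadamard_apply, Matrix.gram_apply, mul_assoc]
  rw [e]
  refine Matrix.PosSemidef.smul (Matrix.posSemidef_sum _ fun f _ => ?_) ?_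
  · exact posSemidef_sum_index _ ((posSemidef_gram _).hadamard
      ((posSemidef_prod _ _ fun k => posSemidef_gram _).hadamard
        (posSemidef_prod _ _ fun k => posSemidef_gram _)))
  · positivity

/-- A simple tensor: degree together with factors. -/
abbrev SimpleTensor (H : Type*) := Σ n : ℕ, Fin n → H

/-- The deformed inner product of simple tensors; different degrees are orthogonal. -/
def simpleForm (N : ℤ) (v w : SimpleTensor H) : ℂ :=
  if h : v.1 = w.1 then tensorForm N v.2 (fun k => w.2 (Fin.cast h k)) else 0

theorem simpleForm_same (N : ℤ) {n : ℕ} (x y : Fin n → H) :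
    simpleForm N ⟨n, x⟩ ⟨n, y⟩ = tensorForm N x y := by
  simp [simpleForm]

theorem simpleForm_ne (N : ℤ) {m n : ℕ} (h : m ≠ n) (x : Fin m → H) (y : Fin n → H) :
    simpleForm N ⟨m, x⟩ ⟨n, y⟩ = 0 := by
  simp [simpleForm, h]

theorem simpleForm_hermitian (N : ℤ) [NeZero N] (v w : SimpleTensor H) :
    star (simpleForm N w v) = simpleForm N v w := by
  obtain ⟨m, x⟩ := v
  obtain ⟨n, y⟩ := w
  rcases eq_or_ne m n with rfl | h
  · rw [simpleForm_same, simpleForm_same]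
    exact (posSemidef_tensorForm N m).1.apply x y
  · rw [simpleForm_ne N h, simpleForm_ne N h.symm, star_zero]

theorem simpleForm_nonneg (N : ℤ) [NeZero N] (c : SimpleTensor H →₀ ℂ) :
    0 ≤ c.sum fun v a => c.sum fun w b => star a * simpleForm N v w * b := by
  classical
  have h : (c.sum fun v a => c.sum fun w b => star a * simpleForm N v w * b) =
      ∑ n ∈ c.splitSupport, (c.split n).sum fun x a => (c.split n).sum fun y b =>
        star a * tensorForm N x y * b := by
    rw [Finsupp.sigma_sum]
    refine Finset.sum_congr rfl fun n hn => Finset.sum_congr rfl fun x _ => ?_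
    simp only
    rw [Finsupp.sigma_sum, Finset.sum_eq_single_of_mem n hn]
    · simp only [simpleForm_same]
    · intro m _ hm
      simp [simpleForm_ne N hm.symm]
  rw [h]
  exact Finset.sum_nonneg fun n _ => (posSemidef_tensorForm N n).2 _

/-- The sesquilinear extension of `simpleForm` to formal linear combinations. -/
def freeForm (N : ℤ) (x y : SimpleTensor H →₀ ℂ) : ℂ :=
  x.sum fun v a => y.sum fun w b => star a * simpleForm N v w * b

theorem freeForm_symm (N : ℤ) [NeZero N] (x y : SimpleTensor H →₀ ℂ) :
    star (freeForm N y x) = freeForm N x y := by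
  unfold freeForm Finsupp.sum
  rw [star_sum, Finset.sum_congr rfl fun _ _ => star_sum _ _, Finset.sum_comm]
  refine Finset.sum_congr rfl fun v _ => Finset.sum_congr rfl fun w _ => ?_
  rw [star_mul', star_mul', star_star, simpleForm_hermitian]
  ring

theorem freeForm_add_left (N : ℤ) (x y z : SimpleTensor H →₀ ℂ) :
    freeForm N (x + y) z = freeForm N x z + freeForm N y z := by
  refine Finsupp.sum_add_index' (fun v => by simp [Finsupp.sum]) (fun v a b => ?_)
  rw [← Finsupp.sum_add]
  simp [star_add, add_mul]

theorem freeForm_smul_left (N : ℤ) (x y : SimpleTensor H →₀ ℂ) (r : ℂ) :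
    freeForm N (r • x) y = star r * freeForm N x y := by
  refine (Finsupp.sum_smul_index (fun v => by simp [Finsupp.sum])).trans ?_
  unfold freeForm
  simp only [Finsupp.sum, Finset.mul_sum, star_mul', mul_assoc]

/-- Finite formal linear combinations of simple tensors with factors in `H`, the raw space that
carries the semi-inner product `⟨·, ·⟩_N`. The multilinearity relations of the tensor product lie
in its kernel (see `tensor`), so they need not be imposed before the kernel is divided out. -/
def PreFock (_N : ℤ) (H : Type*) : Type _ := SimpleTensor H →₀ ℂ

instance (N : ℤ) (H : Type*) : AddCommGroup (PreFock N H) :=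
  inferInstanceAs (AddCommGroup (SimpleTensor H →₀ ℂ))

instance (N : ℤ) (H : Type*) : Module ℂ (PreFock N H) :=
  inferInstanceAs (Module ℂ (SimpleTensor H →₀ ℂ))

@[reducible] def preFockCore (N : ℤ) [NeZero N] (H : Type*) [NormedAddCommGroup H]
    [InnerProductSpace ℂ H] : PreInnerProductSpace.Core ℂ (PreFock N H) where
  inner := freeForm N
  conj_inner_symm := freeForm_symm N
  re_inner_nonneg x := (Complex.nonneg_iff.1 (simpleForm_nonneg N x)).1
  add_left := freeForm_add_left N
  smul_left := freeForm_smul_left N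

instance (N : ℤ) [NeZero N] : SeminormedAddCommGroup (PreFock N H) :=
  @InnerProductSpace.Core.toSeminormedAddCommGroup ℂ _ _ _ _ (preFockCore N H)

instance (N : ℤ) [NeZero N] : InnerProductSpace ℂ (PreFock N H) :=
  InnerProductSpace.ofCore (preFockCore N H)

theorem inner_preFock (N : ℤ) [NeZero N] (x y : PreFock N H) : inner ℂ x y = freeForm N x y := rfl

/-- The algebraic Fock space: linear combinations of simple tensors modulo the kernel of
`⟨·, ·⟩_N`. It is the common dense domain of the creation and annihilation operators. -/
def AlgFock (N : ℤ) [NeZero N] (H : Type*) [NormedAddCommGroup H] [InnerProductSpace ℂ H] :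
    Type _ := SeparationQuotient (PreFock N H)

instance (N : ℤ) [NeZero N] : NormedAddCommGroup (AlgFock N H) :=
  inferInstanceAs (NormedAddCommGroup (SeparationQuotient (PreFock N H)))

instance (N : ℤ) [NeZero N] : InnerProductSpace ℂ (AlgFock N H) :=
  inferInstanceAs (InnerProductSpace ℂ (SeparationQuotient (PreFock N H)))

/-- The Hilbert space `F_N(H)`, the completion of the algebraic Fock space. -/
abbrev FockSpace (N : ℤ) [NeZero N] (H : Type*) [NormedAddCommGroup H] [InnerProductSpace ℂ H] :
    Type _ := UniformSpace.Completion (AlgFock N H)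


/-- The simple tensor `x₁ ⊗ ⋯ ⊗ xₙ`. -/
def simple (N : ℤ) {n : ℕ} (x : Fin n → H) : PreFock N H := Finsupp.single ⟨n, x⟩ 1

/-- Linear extension of a map given on simple tensors. -/
def extend (N : ℤ) (T : (n : ℕ) → (Fin n → H) → PreFock N H) : PreFock N H →ₗ[ℂ] PreFock N H :=
  Finsupp.linearCombination ℂ (fun v : SimpleTensor H => T v.1 v.2)

/-- `ξ₁ ⊗ ⋯ ⊗ ξₙ ↦ ξ ⊗ ξ₁ ⊗ ⋯ ⊗ ξₙ`. -/
def preCreate (N : ℤ) (ξ : H) : PreFock N H →ₗ[ℂ] PreFock N H :=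
  extend N fun _ x => simple N (Fin.cons ξ x)

/-- `Ω ↦ 0` and
`ξ₁ ⊗ ⋯ ⊗ ξₙ ↦ ⟨ξ, ξ₁⟩ ξ₂ ⊗ ⋯ ⊗ ξₙ
  + (1/N) ∑_{k ≥ 2} ⟨ξ, ξ_k⟩ ξ₂ ⊗ ⋯ ⊗ ξ_{k-1} ⊗ ξ₁ ⊗ ξ_{k+1} ⊗ ⋯ ⊗ ξₙ`. -/
def preAnnihilate (N : ℤ) (ξ : H) : PreFock N H →ₗ[ℂ] PreFock N H :=
  extend N fun n x => match n, x with
    | 0, _ => 0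
    | _ + 1, x => inner ℂ ξ (x 0) • simple N (Fin.tail x) +
        (1 / (N : ℂ)) •
          ∑ k, inner ℂ ξ (Fin.tail x k) • simple N (Function.update (Fin.tail x) k (x 0))

theorem inner_simple (N : ℤ) [NeZero N] {m n : ℕ} (x : Fin m → H) (y : Fin n → H) :
    inner ℂ (simple N x) (simple N y) = simpleForm N ⟨m, x⟩ ⟨n, y⟩ := by
  rw [inner_preFock]
  simp [freeForm, simple]

theorem extend_simple (N : ℤ) (T : (n : ℕ) → (Fin n → H) → PreFock N H) {n : ℕ} (x : Fin n → H) :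
    extend N T (simple N x) = T n x := by
  unfold extend simple
  erw [Finsupp.linearCombination_single]
  simp

theorem preFock_induction (N : ℤ) {p : PreFock N H → Prop} (x : PreFock N H)
    (h0 : p 0) (hadd : ∀ x y, p x → p y → p (x + y))
    (hs : ∀ (a : ℂ) (n : ℕ) (x : Fin n → H), p (a • simple N x)) : p x := by
  refine Finsupp.induction_linear x h0 hadd ?_
  rintro ⟨n, x⟩ a
  have := hs a n x
  have e : (a • simple N x : PreFock N H) = (Finsupp.single ⟨n, x⟩ a : SimpleTensor H →₀ ℂ) := by
    exact (Finsupp.smul_single _ _ _).trans (by simp)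
  rwa [e] at this

theorem tensorForm_cons (N : ℤ) [NeZero N] (ξ : H) {n : ℕ} (y : Fin (n + 1) → H) (x : Fin n → H) :
    tensorForm N y (Fin.cons ξ x : Fin (n + 1) → H) =
      inner ℂ (y 0) ξ * tensorForm N (Fin.tail y) x +
        1 / (N : ℂ) * ∑ j, inner ℂ (Fin.tail y j) ξ *
          tensorForm N (Function.update (Fin.tail y) j (y 0)) x := by
  have h : ∀ (p : Fin (n + 1)) (e : Perm (Fin n)),
      (∏ k, inner ℂ (y k) ((Fin.cons ξ x : Fin (n + 1) → H)
        ((Perm.decomposeFin.symm (p, e))⁻¹ k)) : ℂ) =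
      inner ℂ (y p) ξ * ∏ k : Fin n, inner ℂ (y (swap 0 p k.succ)) (x (e⁻¹ k)) := by
    intro p e
    rw [← Equiv.prod_comp (Perm.decomposeFin.symm (p, e))]
    have hs : ∀ k, (Perm.decomposeFin.symm (p, e))⁻¹ (Perm.decomposeFin.symm (p, e) k) = k :=
      fun k => (Perm.decomposeFin.symm (p, e)).symm_apply_apply k
    simp only [hs]
    rw [Fin.prod_univ_succ, ← Equiv.prod_comp e (fun k => (inner ℂ _ (x (e⁻¹ k)) : ℂ))]
    simp
  unfold tensorForm
  rw [← Equiv.sum_comp Perm.decomposeFin.symm, Fintype.sum_prod_type, Fin.sum_univ_succ]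
  simp only [h, charN_decompose_zero, charN_decompose_succ]
  congr 1
  · rw [Finset.mul_sum]
    refine Finset.sum_congr rfl fun e _ => ?_
    simp [Fin.tail]
    ring
  · rw [Finset.mul_sum]
    refine Finset.sum_congr rfl fun j _ => ?_
    rw [Finset.mul_sum, Finset.mul_sum]
    refine Finset.sum_congr rfl fun e _ => ?_
    have : ∀ k : Fin n, y (swap 0 j.succ k.succ) = Function.update (Fin.tail y) j (y 0) k := by
      intro k
      rcases eq_or_ne k j with rfl | hk
      · simp
      · rw [swap_apply_of_ne_of_ne (Fin.succ_ne_zero k) (by simpa using hk)]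
        simp [hk, Fin.tail]
    simp only [this, Fin.tail]
    ring

theorem inner_preAnnihilate (N : ℤ) [NeZero N] (ξ : H) (y x : PreFock N H) :
    inner ℂ (preAnnihilate N ξ y) x = inner ℂ y (preCreate N ξ x) := by
  induction y using preFock_induction with
  | h0 => simp
  | hadd y₁ y₂ h₁ h₂ => rw [map_add, inner_add_left, inner_add_left, h₁, h₂]
  | hs a m y =>
    induction x using preFock_induction with
    | h0 => simp
    | hadd x₁ x₂ h₁ h₂ => rw [map_add, inner_add_right, inner_add_right, h₁, h₂]
    | hs b n x =>
      simp only [map_smul, inner_smul_left, inner_smul_right]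
      congr 2
      unfold preAnnihilate preCreate
      rw [extend_simple, extend_simple]
      cases m with
      | zero => simp [inner_simple, simpleForm]
      | succ m =>
        simp only [inner_add_left, inner_smul_left, sum_inner, inner_simple, inner_conj_symm]
        rcases eq_or_ne m n with rfl | h
        · simp only [simpleForm_same]
          rw [tensorForm_cons]
          simp
        · simp [simpleForm, h]


theorem inner_preCreate (N : ℤ) [NeZero N] (ξ : H) (y x : PreFock N H) :
    inner ℂ (preCreate N ξ y) x = inner ℂ y (preAnnihilate N ξ x) := by
  rw [← inner_conj_symm, ← inner_preAnnihilate, inner_conj_symm]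

/-- A linear map with a formal adjoint preserves the kernel of `⟨·, ·⟩_N`, hence it descends. -/
def descend (N : ℤ) [NeZero N] (T T' : PreFock N H →ₗ[ℂ] PreFock N H)
    (h : ∀ y x, inner ℂ (T y) x = inner ℂ y (T' x)) : Module.End ℂ (AlgFock N H) where
  toFun := SeparationQuotient.lift (fun x => SeparationQuotient.mk (T x)) (by
    intro a b hab
    refine SeparationQuotient.mk_eq_mk.2 ?_
    rw [Metric.inseparable_iff, dist_eq_norm, ← map_sub]
    rw [Metric.inseparable_iff, dist_eq_norm] at hab
    have h1 : ‖T (a - b)‖ ^ 2 ≤ 0 := by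
      rw [@norm_sq_eq_re_inner ℂ, h]
      refine (re_inner_le_norm _ _).trans ?_
      rw [hab, zero_mul]
    exact pow_eq_zero_iff two_ne_zero |>.1 (le_antisymm h1 (sq_nonneg _)))
  map_add' := by
    intro x y
    obtain ⟨x, rfl⟩ := SeparationQuotient.surjective_mk x
    obtain ⟨y, rfl⟩ := SeparationQuotient.surjective_mk y
    exact congrArg SeparationQuotient.mk (map_add T x y)
  map_smul' := by
    intro r x
    obtain ⟨x, rfl⟩ := SeparationQuotient.surjective_mk x
    exact congrArg SeparationQuotient.mk (map_smul T r x)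

/-- The creation operator `L(ξ)`. -/
def create (N : ℤ) [NeZero N] (ξ : H) : Module.End ℂ (AlgFock N H) :=
  descend N (preCreate N ξ) (preAnnihilate N ξ) (inner_preCreate N ξ)

/-- The annihilation operator `L*(ξ)`. -/
def annihilate (N : ℤ) [NeZero N] (ξ : H) : Module.End ℂ (AlgFock N H) :=
  descend N (preAnnihilate N ξ) (preCreate N ξ) (inner_preAnnihilate N ξ)

theorem tensorForm_update (N : ℤ) {n : ℕ} (y x : Fin n → H) (k : Fin n) (v : H) :
    tensorForm N y (Function.update x k v) = ∑ σ : Perm (Fin n), charN N σ *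
      (inner ℂ (y (σ k)) v * ∏ l ∈ Finset.univ.erase k, inner ℂ (y (σ l)) (x l)) := by
  unfold tensorForm
  refine Finset.sum_congr rfl fun σ _ => ?_
  rw [← Equiv.prod_comp σ]
  have hs : ∀ k, σ⁻¹ (σ k) = k := fun k => σ.symm_apply_apply k
  simp only [hs]
  rw [← Finset.mul_prod_erase _ _ (Finset.mem_univ k), Function.update_self]
  congr 2
  refine Finset.prod_congr rfl fun l hl => ?_
  rw [Function.update_of_ne (Finset.ne_of_mem_erase hl)]

theorem ext_simple (N : ℤ) [NeZero N] (u w : PreFock N H)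
    (h : ∀ (n : ℕ) (y : Fin n → H), inner ℂ (simple N y) u = inner ℂ (simple N y) w) :
    (SeparationQuotient.mk u : AlgFock N H) = SeparationQuotient.mk w := by
  have h1 : ∀ z : PreFock N H, inner ℂ z u = inner ℂ z w := by
    intro z
    induction z using preFock_induction with
    | h0 => simp
    | hadd y₁ y₂ h₁ h₂ => rw [inner_add_left, inner_add_left, h₁, h₂]
    | hs a m y => rw [inner_smul_left, inner_smul_left, h]
  refine SeparationQuotient.mk_eq_mk.2 ?_
  rw [Metric.inseparable_iff, dist_eq_norm]
  refine pow_eq_zero_iff two_ne_zero |>.1 ?_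
  rw [@norm_sq_eq_re_inner ℂ, inner_sub_right, h1, sub_self, map_zero]

/-- The simple tensors in the algebraic Fock space; they are multilinear in their factors. -/
def tensor (N : ℤ) [NeZero N] (n : ℕ) : MultilinearMap ℂ (fun _ : Fin n => H) (AlgFock N H) where
  toFun x := SeparationQuotient.mk (simple N x)
  map_update_add' := by
    intro inst x k a b
    obtain rfl : inst = instDecidableEqFin n := Subsingleton.elim _ _
    refine ext_simple N _ (simple N _ + simple N _) fun m y => ?_
    rw [inner_add_right, inner_simple, inner_simple, inner_simple]
    rcases eq_or_ne m n with rfl | h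
    · simp only [simpleForm_same]
      simp only [tensorForm_update, ← Finset.sum_add_distrib, inner_add_right, add_mul, mul_add]
    · simp [simpleForm, h]
  map_update_smul' := by
    intro inst x k r a
    obtain rfl : inst = instDecidableEqFin n := Subsingleton.elim _ _
    refine ext_simple N _ (r • simple N _) fun m y => ?_
    rw [inner_smul_right, inner_simple, inner_simple]
    rcases eq_or_ne m n with rfl | h
    · simp only [simpleForm_same]
      simp only [tensorForm_update, Finset.mul_sum, inner_smul_right]
      refine Finset.sum_congr rfl fun σ _ => ?_
      ring
    · simp [simpleForm, h]

theorem create_tensor (N : ℤ) [NeZero N] (ξ : H) {n : ℕ} (x : Fin n → H) :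
    create N ξ (tensor N n x) = tensor N (n + 1) (Fin.cons ξ x : Fin (n + 1) → H) :=
  congrArg SeparationQuotient.mk (extend_simple N _ x)

theorem annihilate_tensor (N : ℤ) [NeZero N] (ξ : H) {n : ℕ} (x : Fin (n + 1) → H) :
    annihilate N ξ (tensor N (n + 1) x) = inner ℂ ξ (x 0) • tensor N n (Fin.tail x) +
        (1 / (N : ℂ)) • ∑ k, inner ℂ ξ (Fin.tail x k) •
          tensor N n (Function.update (Fin.tail x) k (x 0)) := by
  refine (congrArg SeparationQuotient.mk (extend_simple N _ x)).trans ?_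
  change (SeparationQuotient.mkCLM ℂ (PreFock N H)) _ = _
  simp only [map_add, map_smul, map_sum]
  rfl

theorem inner_annihilate (N : ℤ) [NeZero N] (ξ : H) (y x : AlgFock N H) :
    inner ℂ (annihilate N ξ y) x = inner ℂ y (create N ξ x) := by
  obtain ⟨x, rfl⟩ := SeparationQuotient.surjective_mk x
  obtain ⟨y, rfl⟩ := SeparationQuotient.surjective_mk y
  exact inner_preAnnihilate N ξ y x

/-- The vacuum vector `Ω`, the empty tensor. -/
def vacuum (N : ℤ) [NeZero N] (H : Type*) [NormedAddCommGroup H] [InnerProductSpace ℂ H] :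
    AlgFock N H :=
  tensor N 0 Fin.elim0

/-- The vacuum expectation `ρ(T) = ⟨Ω, T Ω⟩`, the inner product being that of `F_N(H)`. -/
def vacuumState (N : ℤ) [NeZero N] (T : Module.End ℂ (AlgFock N H)) : ℂ :=
  inner ℂ (vacuum N H : FockSpace N H) (T (vacuum N H) : FockSpace N H)

end Kernel

end

section

open Equiv
open scoped Classical

/-- A pair partition of `{0, …, m - 1}`, encoded by the involution that exchanges the two elements
of each pair. -/
def IsPairPartition {m : ℕ} (π : Perm (Fin m)) : Prop :=
  ∀ j, π j ≠ j ∧ π (π j) = j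

/-- The left points (smaller elements) of the pairs. -/
def leftPoints {m : ℕ} (π : Perm (Fin m)) : Finset (Fin m) :=
  Finset.univ.filter fun j => j < π j

/-- No two pairs `{j < π j}`, `{k < π k}` satisfy `j < k < π j < π k`. -/
def IsNoncrossing {m : ℕ} (π : Perm (Fin m)) : Prop :=
  ∀ j k, j < k → k < π j → ¬ π j < π k

/-- The number of elements of `S` minus the number of non-elements among the first `k` points. -/
def setHeight {m : ℕ} (S : Finset (Fin m)) (k : ℕ) : ℤ :=
  ∑ j ∈ Finset.univ.filter (fun j : Fin m => (j : ℕ) < k), if j ∈ S then 1 else -1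

/-- The sets that can occur as left points of a pair partition. -/
def IsBallot {m : ℕ} (S : Finset (Fin m)) : Prop :=
  (∀ k, 0 ≤ setHeight S k) ∧ setHeight S m = 0

theorem setHeight_succ {m : ℕ} (S : Finset (Fin m)) (j : Fin m) :
    setHeight S (j + 1) = setHeight S j + if j ∈ S then 1 else -1 := by
  unfold setHeight
  have : (Finset.univ.filter fun i : Fin m => (i : ℕ) < j + 1) =
      insert j (Finset.univ.filter fun i : Fin m => (i : ℕ) < j) := by
    ext i
    simp [Fin.ext_iff]
    omega
  rw [this, Finset.sum_insert (by simp), add_comm]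

theorem setHeight_sub {m : ℕ} (S : Finset (Fin m)) {a b : ℕ} (h : a ≤ b) :
    setHeight S b = setHeight S a +
      ∑ j ∈ Finset.univ.filter (fun j : Fin m => a ≤ (j : ℕ) ∧ (j : ℕ) < b), if j ∈ S then 1 else -1 := by
  unfold setHeight
  rw [← Finset.sum_union]
  · congr 1
    ext i
    simp
    omega
  · rw [Finset.disjoint_left]
    intro i
    simp
    omega

/-- `r` is the first point after `l` where the height returns to its value before `l`. -/
def Matched {m : ℕ} (S : Finset (Fin m)) (l r : Fin m) : Prop :=
  l ∈ S ∧ r ∉ S ∧ l < r ∧ setHeight S (r + 1) = setHeight S l ∧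
    ∀ k : ℕ, (l : ℕ) < k → k ≤ r → setHeight S l < setHeight S k

theorem exists_matched {m : ℕ} {S : Finset (Fin m)} (hS : IsBallot S) {l : Fin m} (hl : l ∈ S) :
    ∃ r, Matched S l r := by
  have hex : ∃ k : ℕ, (l : ℕ) < k ∧ setHeight S k ≤ setHeight S l :=
    ⟨m, l.2, by rw [hS.2]; exact hS.1 l⟩
  obtain ⟨h1, h2⟩ := Nat.find_spec hex
  have hmin := fun k (hk : k < Nat.find hex) => Nat.find_min hex hk
  have hle : Nat.find hex ≤ m := Nat.find_min' hex ⟨l.2, by rw [hS.2]; exact hS.1 l⟩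
  generalize Nat.find hex = k₀ at *
  obtain ⟨r, rfl⟩ : ∃ r, k₀ = r + 1 := ⟨k₀ - 1, by omega⟩
  have hsl := setHeight_succ S l
  rw [if_pos hl] at hsl
  have hlr : (l : ℕ) < r := by
    rcases Nat.lt_or_ge (l : ℕ) r with h | h
    · exact h
    · have : r = l := by omega
      subst this
      omega
  have hr := hmin r (by omega)
  have hsr := setHeight_succ S ⟨r, by omega⟩
  simp only at hsr
  have hlt : setHeight S l < setHeight S r := by
    by_contra hc
    exact hr ⟨hlr, by omega⟩
  have hrS : (⟨r, by omega⟩ : Fin m) ∉ S := by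
    intro hmem
    rw [if_pos hmem] at hsr
    omega
  rw [if_neg hrS] at hsr
  refine ⟨⟨r, by omega⟩, hl, hrS, by simpa [Fin.lt_def] using hlr, by simp only; omega, ?_⟩
  intro k hk1 hk2
  by_contra hc
  exact hmin k (by simp only at hk2; omega) ⟨hk1, by omega⟩

theorem Matched.right_unique {m : ℕ} {S : Finset (Fin m)} {l r r' : Fin m}
    (h : Matched S l r) (h' : Matched S l r') : r = r' := by
  obtain ⟨-, -, h1, h2, h3⟩ := h
  obtain ⟨-, -, h1', h2', h3'⟩ := h'
  rw [Fin.lt_def] at h1 h1'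
  rcases lt_trichotomy (r : ℕ) r' with h | h | h
  · have := h3' (r + 1) (by omega) (by omega); omega
  · exact Fin.ext h
  · have := h3 (r' + 1) (by omega) (by omega); omega

theorem Matched.left_unique {m : ℕ} {S : Finset (Fin m)} {l l' r : Fin m}
    (h : Matched S l r) (h' : Matched S l' r) : l = l' := by
  obtain ⟨-, -, h1, h2, h3⟩ := h
  obtain ⟨-, -, h1', h2', h3'⟩ := h'
  rw [Fin.lt_def] at h1 h1'
  rcases lt_trichotomy (l : ℕ) l' with h | h | h
  · have := h3 l' h (by omega); omega
  · exact Fin.ext h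
  · have := h3' l h (by omega); omega

theorem card_eq_of_ballot {m : ℕ} {S : Finset (Fin m)} (hS : IsBallot S) :
    S.card = Sᶜ.card := by
  have h := hS.2
  unfold setHeight at h
  rw [Finset.filter_true_of_mem (fun j _ => j.2), Finset.sum_ite] at h
  simp only [Finset.filter_mem_eq_inter, Finset.univ_inter, Finset.sum_const,
    Finset.filter_notMem_eq_sdiff] at h
  rw [Finset.compl_eq_univ_sdiff]
  simp at h ⊢
  omega

theorem exists_matched_right {m : ℕ} {S : Finset (Fin m)} (hS : IsBallot S) {r : Fin m}
    (hr : r ∉ S) : ∃ l, Matched S l r := by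
  choose f hf using fun l : S => exists_matched hS l.2
  have hinj : Function.Injective fun l : S => (⟨f l, by simpa using (hf l).2.1⟩ : (Sᶜ : Finset (Fin m))) := by
    intro a b hab
    have hab' : f a = f b := congrArg Subtype.val hab
    have h1 := hf a
    rw [hab'] at h1
    exact Subtype.ext (h1.left_unique (hf b))
  have hb := (Fintype.bijective_iff_injective_and_card _).2
    ⟨hinj, by rw [Fintype.card_coe, Fintype.card_coe]; exact card_eq_of_ballot hS⟩
  obtain ⟨l, hl⟩ := hb.2 ⟨r, by simpa using hr⟩
  have hl' : f l = r := congrArg Subtype.val hl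
  exact ⟨l, hl' ▸ hf l⟩

theorem exists_noncrossing {m : ℕ} {S : Finset (Fin m)} (hS : IsBallot S) :
    ∃ π : Perm (Fin m), IsPairPartition π ∧ IsNoncrossing π ∧ leftPoints π = S := by
  have hex : ∀ j : Fin m, ∃ k, Matched S j k ∨ Matched S k j := by
    intro j
    by_cases hj : j ∈ S
    · obtain ⟨k, hk⟩ := exists_matched hS hj; exact ⟨k, .inl hk⟩
    · obtain ⟨k, hk⟩ := exists_matched_right hS hj; exact ⟨k, .inr hk⟩
  choose f hf using hex
  have hinv : Function.Involutive f := by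
    intro j
    rcases hf j with h | h
    · rcases hf (f j) with h' | h'
      · exact absurd h'.1 h.2.1
      · exact h'.left_unique h
    · rcases hf (f j) with h' | h'
      · exact h'.right_unique h
      · exact absurd h.1 h'.2.1
  have hleft : ∀ j, j < f j ↔ j ∈ S := by
    intro j
    rcases hf j with h | h
    · exact ⟨fun _ => h.1, fun _ => h.2.2.1⟩
    · exact ⟨fun h' => absurd h' (not_lt.2 h.2.2.1.le), fun h' => absurd h' h.2.1⟩
  refine ⟨hinv.toPerm f, fun j => ⟨?_, hinv j⟩, ?_, ?_⟩
  · change f j ≠ j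
    rcases hf j with h | h
    · exact h.2.2.1.ne'
    · exact h.2.2.1.ne
  · intro j k hjk hkj hcr
    change k < f j at hkj
    change f j < f k at hcr
    have hj : Matched S j (f j) := by
      rcases hf j with h | h
      · exact h
      · exact absurd (hjk.trans hkj) (not_lt.2 h.2.2.1.le)
    have hk : Matched S k (f k) := by
      rcases hf k with h | h
      · exact h
      · exact absurd (hkj.trans hcr) (not_lt.2 h.2.2.1.le)
    rw [Fin.lt_def] at hjk hkj hcr
    have h1 := hj.2.2.2.2 k hjk hkj.le
    have h2 := hk.2.2.2.2 (f j + 1) (by omega) (by omega)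
    have h3 := hj.2.2.2.1
    omega
  · ext j
    simp only [leftPoints, Finset.mem_filter, Finset.mem_univ, true_and]
    exact hleft j

theorem matched_of_noncrossing {m : ℕ} {π : Perm (Fin m)} (hp : IsPairPartition π)
    (hn : IsNoncrossing π) {l : Fin m} (hl : l ∈ leftPoints π) :
    Matched (leftPoints π) l (π l) := by
  have hmem : ∀ j, j ∈ leftPoints π ↔ j < π j := by
    intro j; simp [leftPoints]
  have hsgn : ∀ j, (if j ∈ leftPoints π then (1 : ℤ) else -1) +
      (if π j ∈ leftPoints π then (1 : ℤ) else -1) = 0 := by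
    intro j
    simp only [hmem, (hp j).2]
    have := (hp j).1
    rcases lt_or_gt_of_ne this with h | h
    · rw [if_neg (not_lt.2 h.le), if_pos h]; rfl
    · rw [if_pos h, if_neg (not_lt.2 h.le)]; rfl
  have hlt := (hmem l).1 hl
  have hzero : ∀ A : Finset (Fin m), (∀ j ∈ A, π j ∈ A) →
      ∑ j ∈ A, (if j ∈ leftPoints π then (1 : ℤ) else -1) = 0 := fun A hA =>
    Finset.sum_involution (fun j _ => π j) (fun j _ => hsgn j) (fun j _ _ => (hp j).1)
      (fun j hj => hA j hj) (fun j _ => (hp j).2)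
  have hin : ∀ j, l < j → j < π l → l < π j ∧ π j < π l := by
    intro j h1 h2
    have hne1 : π j ≠ l := by
      intro h; have := (hp j).2; rw [h] at this; exact absurd this h2.ne'
    have hne2 : π j ≠ π l := fun h => h1.ne' (π.injective h)
    constructor
    · by_contra hc
      have hc' : π j < l := lt_of_le_of_ne (not_lt.1 hc) hne1
      exact hn (π j) l hc' (by rw [(hp j).2]; exact h1) (by rw [(hp j).2]; exact h2)
    · by_contra hc
      exact hn l j h1 h2 (lt_of_le_of_ne (not_lt.1 hc) hne2.symm)
  refine ⟨hl, ?_, hlt, ?_, ?_⟩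
  · rw [hmem, (hp l).2]; exact not_lt.2 hlt.le
  · rw [setHeight_sub _ (show (l : ℕ) ≤ π l + 1 by rw [Fin.lt_def] at hlt; omega), hzero, add_zero]
    intro j hj
    simp only [Finset.mem_filter, Finset.mem_univ, true_and] at hj ⊢
    rcases eq_or_ne j l with rfl | h1
    · rw [Fin.lt_def] at hlt; omega
    rcases eq_or_ne j (π l) with rfl | h2
    · rw [(hp l).2]; rw [Fin.lt_def] at hlt; omega
    have h1' : (j : ℕ) ≠ l := fun h => h1 (Fin.ext h)
    have h2' : (j : ℕ) ≠ π l := fun h => h2 (Fin.ext h)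
    have := hin j (by rw [Fin.lt_def]; omega) (by rw [Fin.lt_def]; omega)
    rw [Fin.lt_def, Fin.lt_def] at this
    omega
  · intro k hk1 hk2
    rw [setHeight_sub _ hk1.le]
    set I : Finset (Fin m) := Finset.univ.filter fun j => (l : ℕ) ≤ j ∧ (j : ℕ) < k with hI
    have hIm : ∀ j, j ∈ I ↔ (l : ℕ) ≤ j ∧ (j : ℕ) < k := by intro j; simp [hI]
    rw [← Finset.sum_filter_add_sum_filter_not I (fun j => π j ∈ I), hzero, zero_add]
    · have hone : ∀ j ∈ I.filter (fun j => ¬ π j ∈ I),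
          (if j ∈ leftPoints π then (1 : ℤ) else -1) = 1 := by
        intro j hj
        rw [Finset.mem_filter, hIm, hIm] at hj
        rw [if_pos]
        rw [hmem]
        rcases eq_or_ne j l with rfl | h1
        · exact hlt
        have h1' : (j : ℕ) ≠ l := fun h => h1 (Fin.ext h)
        have := hin j (by rw [Fin.lt_def]; omega) (by rw [Fin.lt_def]; omega)
        rw [Fin.lt_def, Fin.lt_def] at this
        rw [Fin.lt_def]
        omega
      rw [Finset.sum_congr rfl hone]
      have : l ∈ I.filter (fun j => ¬ π j ∈ I) := by
        rw [Finset.mem_filter, hIm, hIm]; omega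
      have := Finset.card_pos.2 ⟨l, this⟩
      simp only [Finset.sum_const, nsmul_eq_mul, mul_one]
      omega
    · intro j hj
      rw [Finset.mem_filter] at hj ⊢
      exact ⟨hj.2, by rw [(hp j).2]; exact hj.1⟩

/-- There is exactly one noncrossing pair partition with prescribed left points. -/
theorem existsUnique_noncrossing {m : ℕ} {S : Finset (Fin m)} (hS : IsBallot S) :
    ∃! π : Perm (Fin m), IsPairPartition π ∧ IsNoncrossing π ∧ leftPoints π = S := by
  obtain ⟨π, hπ⟩ := exists_noncrossing hS
  refine ⟨π, hπ, fun ρ hρ => ?_⟩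
  obtain ⟨hp, hn, rfl⟩ := hπ
  obtain ⟨hp', hn', hS'⟩ := hρ
  have key : ∀ l ∈ leftPoints π, ρ l = π l := by
    intro l hl
    have h1 := matched_of_noncrossing hp' hn' (hS' ▸ hl)
    rw [hS'] at h1
    exact h1.right_unique (matched_of_noncrossing hp hn hl)
  ext1 j
  by_cases hj : j ∈ leftPoints π
  · exact key j hj
  · have h2 : π j ∈ leftPoints π := by
      simp only [leftPoints, Finset.mem_filter, Finset.mem_univ, true_and, (hp j).2, not_lt] at hj ⊢
      exact lt_of_le_of_ne hj (hp j).1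
    have h3 := key _ h2
    rw [(hp j).2] at h3
    rw [← (hp' (π j)).2, h3]

theorem isBallot_leftPoints {m : ℕ} {π : Perm (Fin m)} (hp : IsPairPartition π) :
    IsBallot (leftPoints π) := by
  have hmem : ∀ j, j ∈ leftPoints π ↔ j < π j := by
    intro j; simp [leftPoints]
  have hsgn : ∀ j, (if j ∈ leftPoints π then (1 : ℤ) else -1) +
      (if π j ∈ leftPoints π then (1 : ℤ) else -1) = 0 := by
    intro j
    simp only [hmem, (hp j).2]
    have := (hp j).1
    rcases lt_or_gt_of_ne this with h | h
    · rw [if_neg (not_lt.2 h.le), if_pos h]; rfl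
    · rw [if_pos h, if_neg (not_lt.2 h.le)]; rfl
  have hzero : ∀ A : Finset (Fin m), (∀ j ∈ A, π j ∈ A) →
      ∑ j ∈ A, (if j ∈ leftPoints π then (1 : ℤ) else -1) = 0 := fun A hA =>
    Finset.sum_involution (fun j _ => π j) (fun j _ => hsgn j) (fun j _ _ => (hp j).1)
      (fun j hj => hA j hj) (fun j _ => (hp j).2)
  refine ⟨fun k => ?_, hzero _ fun j _ => by simp⟩
  unfold setHeight
  rw [← Finset.sum_filter_add_sum_filter_not _ (fun j => ((π j : Fin m) : ℕ) < k), hzero, zero_add]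
  · refine Finset.sum_nonneg fun j hj => ?_
    simp only [Finset.mem_filter, Finset.mem_univ, true_and] at hj
    rw [if_pos]
    · exact zero_le_one
    · rw [hmem, Fin.lt_def]; omega
  · intro j hj
    simp only [Finset.mem_filter, Finset.mem_univ, true_and] at hj ⊢
    rw [(hp j).2]
    exact ⟨hj.2, hj.1⟩

/-- The exponents `ε ∈ {*, 1}`: `star` marks an annihilator, `one` a creator. -/
inductive Exponent
  | star
  | one

/-- Annihilators are steps down, creators are steps up. -/
def Exponent.step : Exponent → ℤ
  | .star => -1
  | .one => 1

/-- The coordinate of colour `c` of the lattice path of the word, after the letters with index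
`≥ k` have acted; operators act on the vacuum from the right, so the path is read from right to
left. -/
def colourHeight {m : ℕ} {ι : Type*} (i : Fin m → ι) (ε : Fin m → Exponent) (c : ι) (k : ℕ) : ℤ :=
  ∑ j ∈ Finset.univ.filter (fun j : Fin m => k ≤ (j : ℕ) ∧ i j = c), (ε j).step

/-- Multidimensional Dyck words: every coordinate of the path stays `≥ 0` and ends at `0`. -/
def IsDyckWord {m : ℕ} {ι : Type*} (i : Fin m → ι) (ε : Fin m → Exponent) : Prop :=
  ∀ c, colourHeight i ε c 0 = 0 ∧ ∀ k, 0 ≤ colourHeight i ε c k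

/-- The positions of the annihilators. -/
def annihilators {m : ℕ} (ε : Fin m → Exponent) : Finset (Fin m) :=
  Finset.univ.filter fun j => ε j = .star

theorem isBallot_annihilators {m : ℕ} {ι : Type*} {i : Fin m → ι} {ε : Fin m → Exponent}
    (h : IsDyckWord i ε) : IsBallot (annihilators ε) := by
  have hs : ∀ k, ∑ c ∈ Finset.univ.image i, colourHeight i ε c k =
      ∑ j ∈ Finset.univ.filter (fun j : Fin m => k ≤ (j : ℕ)), (ε j).step := by
    intro k
    unfold colourHeight
    rw [← Finset.sum_fiberwise_of_maps_to (t := Finset.univ.image i) (g := i) (by simp)]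
    simp only [Finset.filter_filter]
  have hk : ∀ k, setHeight (annihilators ε) k =
      ∑ c ∈ Finset.univ.image i, colourHeight i ε c k := by
    intro k
    have h0 : ∑ j, (ε j).step = 0 := by
      have := hs 0
      rw [Finset.sum_eq_zero (fun c _ => (h c).1)] at this
      simpa using this.symm
    have h1 : ∀ j, (if j ∈ annihilators ε then (1 : ℤ) else -1) = -(ε j).step := by
      intro j
      cases hj : ε j <;> simp [annihilators, hj, Exponent.step]
    rw [hs]
    unfold setHeight
    rw [Finset.sum_congr rfl fun j _ => h1 j, Finset.sum_neg_distrib]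
    rw [← Finset.sum_filter_add_sum_filter_not _ (fun j : Fin m => (j : ℕ) < k)] at h0
    simp only [not_lt] at h0
    linarith
  refine ⟨fun k => ?_, ?_⟩
  · rw [hk]
    exact Finset.sum_nonneg fun c _ => (h c).2 k
  · rw [hk, hs]
    exact Finset.sum_eq_zero fun j hj => absurd (Finset.mem_filter.1 hj).2 (by omega)

/-- The noncrossing pair partition with set of left points `S`. It exists and is unique by
`existsUnique_noncrossing` for all `S` that are met here; the value `1` elsewhere is a default. -/
def noncrossing {m : ℕ} (S : Finset (Fin m)) : Perm (Fin m) :=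
  if h : ∃ π : Perm (Fin m), IsPairPartition π ∧ IsNoncrossing π ∧ leftPoints π = S then h.choose
  else 1

theorem noncrossing_spec {m : ℕ} {S : Finset (Fin m)} (hS : IsBallot S) :
    IsPairPartition (noncrossing S) ∧ IsNoncrossing (noncrossing S) ∧
      leftPoints (noncrossing S) = S := by
  unfold noncrossing
  rw [dif_pos (exists_noncrossing hS)]
  exact (exists_noncrossing hS).choose_spec

/-- The number `c(π)` of cycles of a pair partition. The pair `(l, r)` is followed by the pair
`(l', r')` if `(l, r')` is a pair of the noncrossing partition `π̂` with the same left points;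
pairs are represented by their left points. -/
def pairCycleCount {m : ℕ} (π : Perm (Fin m)) : ℕ :=
  Nat.card (Quot fun l l' : leftPoints π => noncrossing (leftPoints π) l = π l')

/-- `t_N(π) = (1/N) ^ (|π| - c(π))`, where `|π|` is the number of pairs. -/
def tN (N : ℤ) {m : ℕ} (π : Perm (Fin m)) : ℂ :=
  (1 / (N : ℂ)) ^ (((leftPoints π).card : ℤ) - (pairCycleCount π : ℤ))

/-- `Q(ε, ε') = 1` if `ε = *` and `ε' = 1`, and `0` otherwise. -/
def Q : Exponent → Exponent → ℂ
  | .star, .one => 1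
  | _, _ => 0

/-- The value at `L^{ε_1}(ξ_1) ⋯ L^{ε_m}(ξ_m)` of the Fock state given by a function `t` on pair
partitions: the sum over all pair partitions `π` of
`t(π) ∏_{{k < l} ∈ π} Q(ε_k, ε_l) ⟨ξ_k, ξ_l⟩`. -/
def pairPartitionState {H : Type*} [NormedAddCommGroup H] [InnerProductSpace ℂ H] {m : ℕ}
    (t : Perm (Fin m) → ℂ) (ε : Fin m → Exponent) (ξ : Fin m → H) : ℂ :=
  ∑ π ∈ Finset.univ.filter (fun π : Perm (Fin m) => IsPairPartition π),
    t π * ∏ k ∈ leftPoints π, Q (ε k) (ε (π k)) * inner ℂ (ξ k) (ξ (π k))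

/-- The letter `L^ε(ξ)`. -/
def letter {H : Type*} [NormedAddCommGroup H] [InnerProductSpace ℂ H] (N : ℤ) [NeZero N]
    (ε : Exponent) (ξ : H) : Module.End ℂ (AlgFock N H) :=
  match ε with
  | .star => annihilate N ξ
  | .one => create N ξ

/-- The product of operators `L^{ε_1}(ξ_1) L^{ε_2}(ξ_2) ⋯ L^{ε_m}(ξ_m)`. -/
def word {H : Type*} [NormedAddCommGroup H] [InnerProductSpace ℂ H] (N : ℤ) [NeZero N] {m : ℕ}
    (ε : Fin m → Exponent) (ξ : Fin m → H) : Module.End ℂ (AlgFock N H) :=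
  (List.ofFn fun j => letter N (ε j) (ξ j)).prod

/-- The digraph `Γ` of a word. Its vertices are the annihilators; there is an arrow from `p` to
`p'` if the creator `b(p')` that the noncrossing pair partition attaches to `p'` has the colour of
`p` and stands to the right of `p`. -/
def wordDigraph {m : ℕ} {ι : Type*} (i : Fin m → ι) (ε : Fin m → Exponent) :
    Digraph (annihilators ε) where
  Adj p p' := i p = i (noncrossing (annihilators ε) p') ∧ p < noncrossing (annihilators ε) p'

/-- A cycle cover (a cover of the vertices by vertex-disjoint directed cycles, a loop being a cycle
of length one), encoded by the permutation that moves each vertex one step along its cycle. -/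
def IsCycleCover {V : Type*} (Γ : Digraph V) (σ : Perm V) : Prop :=
  ∀ v, Γ.Adj v (σ v)

/-- The cycle cover polynomial `C_c(Γ; x) = ∑_C x ^ |C|`, the sum over all cycle covers `C`, where
`|C|` is the number of cycles of `C`. -/
def cycleCoverPolynomial {V : Type*} [Fintype V] (Γ : Digraph V) : Polynomial ℤ :=
  ∑ σ ∈ Finset.univ.filter (fun σ : Perm V => IsCycleCover Γ σ), Polynomial.X ^ cycleCount σ

end

end CharFock

end

namespace CharFock

open Equiv

/-! Both states are computed for arbitrary vectors `ξ` as `N ^ (-n)` times one and the same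
quantity: the cycle permanent `∑_σ N ^ c(σ) ∏_p M p (σ p)` over permutations of the annihilator
positions, where `M p p'` is `⟨ξ_p, ξ_{b(p')}⟩` if `b(p')` is to the right of `p` and `0` otherwise.
When `ξ` takes values in an orthonormal family, `M` is the adjacency matrix of `Γ`, so exactly the
cycle covers survive and the permanent is `C_c(Γ; N)` (`cyclePermanent_eq_cycleCoverPolynomial`).

For the vacuum expectation, the point is that the annihilation formula and the expansion of a cycle
permanent along a row have the same shape (`cyclePermanent_insert`). A new index `k` is either a
fixed point, which costs a factor `N`, or is spliced into a cycle on the arrow into some `p`, which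
leaves the cycle count alone and replaces column `p` by column `k`. Likewise `L*` either removes the
first factor with weight `1`, or contracts another factor and puts the first one in its place with
weight `1/N`. The two recursions differ by one factor `N` per annihilator.
`vacuum_prefix_eq_cyclePermanent` turns this into an induction on the length of a prefix of the
word. The factors of the tensor on which the prefix acts are labelled by the noncrossing pairs still
open; noncrossing pairs open and close like a stack, so the acting letter always meets the first
factor.

For the pair partitions, `Q` leaves only those whose left points are the annihilators. They
correspond to the permutations `σ` with `p < b(σ p)` for all `p`, by pairing `p` with `b(σ p)`
(`reconnect`); the cycles of the partition become the cycles of `σ` (`pairCycleCount_eq`), and the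
sum becomes the permanent term by term (`pairPartitionState_tN_eq_cyclePermanent`). -/

/-! ### Cycle counts under relabelling and one-point extension. -/

/-- A permutation has `2 ^ c` invariant functions to `Fin 2`, so cycle counts can be compared by a
bijection of invariant functions, without handling orbits. The lemmas on `decomposeOption` use the
same device. -/
theorem cycleCount_eq_of_equiv {V W : Type*} [Finite V] [Finite W] (f : V ≃ W) {σ : Perm V}
    {τ : Perm W} (h : ∀ v, f (σ v) = τ (f v)) : cycleCount σ = cycleCount τ := by
  refine Nat.pow_right_injective (le_refl 2) ?_
  simp only
  rw [← card_invariant, ← card_invariant]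
  refine Nat.card_congr (Equiv.subtypeEquiv (Equiv.arrowCongr f (Equiv.refl _)) fun g => ?_)
  simp only [arrowCongr_apply, coe_refl, Function.comp_apply]
  refine ⟨fun hg w => ?_, fun hg v => ?_⟩
  · obtain ⟨v, rfl⟩ := f.surjective w
    rw [← h, f.symm_apply_apply, f.symm_apply_apply]
    exact hg v
  · simpa [← h] using hg (f v)

/-- Here `none` is fixed, so the value of an invariant function at `none` is free: one more cycle.
-/
theorem cycleCount_decomposeOption_none {V : Type*} [Finite V] [DecidableEq V] (e : Perm V) :
    cycleCount (Perm.decomposeOption.symm (none, e)) = cycleCount e + 1 := by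
  have key : Nat.card {f : Option V → Fin 2 //
      ∀ x, f (Perm.decomposeOption.symm (none, e) x) = f x} =
      Nat.card (Fin 2 × {f : V → Fin 2 // ∀ x, f (e x) = f x}) := by
    refine Nat.card_congr
      { toFun := fun f => (f.1 none, ⟨fun x => f.1 (some x), fun x => ?_⟩)
        invFun := fun g => ⟨fun x => x.elim g.1 g.2.1, fun x => ?_⟩
        left_inv := fun f => ?_
        right_inv := fun g => ?_ }
    · simpa using f.2 (some x)
    · cases x with
      | none => simp
      | some y => simpa using g.2.2 y
    · ext x
      cases x <;> simp
    · ext <;> simp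
  rw [card_invariant, Nat.card_prod, card_invariant, Nat.card_fin] at key
  refine Nat.pow_right_injective (le_refl 2) ?_
  simp only
  rw [key, pow_succ, mul_comm]

theorem decomposeOption_symm_some_apply_some {V : Type*} [DecidableEq V] (p : V) (e : Perm V) (x : V) :
    Perm.decomposeOption.symm (some p, e) (some x) = if e x = p then none else some (e x) := by
  simp [swap_apply_def]

/-- Here `none` is spliced into the arrow of `e` that ends in `p`, so an invariant function is
forced at `none` to take its value at `p`. -/
theorem cycleCount_decomposeOption_some {V : Type*} [Finite V] [DecidableEq V] (p : V) (e : Perm V) :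
    cycleCount (Perm.decomposeOption.symm (some p, e)) = cycleCount e := by
  have key : Nat.card {f : Option V → Fin 2 //
      ∀ x, f (Perm.decomposeOption.symm (some p, e) x) = f x} =
      Nat.card {f : V → Fin 2 // ∀ x, f (e x) = f x} := by
    refine Nat.card_congr
      { toFun := fun f => ⟨fun x => f.1 (some x), fun x => ?_⟩
        invFun := fun g => ⟨fun x => x.elim (g.1 p) g.1, fun x => ?_⟩
        left_inv := fun f => ?_
        right_inv := fun g => ?_ }
    · have h0 := f.2 none
      have h1 := f.2 (some x)
      rw [decomposeOption_symm_some_apply_some] at h1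
      split_ifs at h1 with hx
      · change f.1 (some (e x)) = f.1 (some x)
        rw [hx, ← h1, ← h0]
        simp
      · exact h1
    · cases x with
      | none => simp
      | some y =>
        rw [decomposeOption_symm_some_apply_some]
        have := g.2 y
        split_ifs with hx
        · simpa [hx] using this
        · simpa using this
    · have h0 := f.2 none
      ext x
      cases x with
      | none => simpa using congrArg Fin.val h0
      | some y => simp
    · ext; simp
  rw [card_invariant, card_invariant] at key
  exact Nat.pow_right_injective (le_refl 2) key

/-! ### Cycle permanents and their row expansion. -/

/-- The sum `∑_σ a ^ c(σ) ∏_v M v (σ v)` over the permutations of `V` (an `α`-permanent). -/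
noncomputable def cyclePermanent {V : Type*} [Fintype V] [DecidableEq V] (a : ℂ) (M : V → V → ℂ) : ℂ :=
  ∑ σ : Perm V, a ^ cycleCount σ * ∏ v, M v (σ v)

theorem cyclePermanent_equiv {V W : Type*} [Fintype V] [Fintype W] [DecidableEq V] [DecidableEq W] (f : V ≃ W) (a : ℂ)
    (M : W → W → ℂ) : cyclePermanent a (fun v w => M (f v) (f w)) = cyclePermanent a M := by
  unfold cyclePermanent
  rw [← Equiv.sum_comp f.permCongr]
  refine Finset.sum_congr rfl fun σ _ => ?_
  rw [cycleCount_eq_of_equiv f (τ := f.permCongr σ) (by simp), ← Equiv.prod_comp f]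
  simp

/-- Expansion of a cycle permanent along the row `none`. -/
theorem cyclePermanent_option {V : Type*} [Fintype V] [DecidableEq V] (a : ℂ) (M : Option V → Option V → ℂ) :
    cyclePermanent a M =
      a * M none none * cyclePermanent a (fun v w => M (some v) (some w)) +
      ∑ p, M none (some p) *
        cyclePermanent a (fun v w => M (some v) (if w = p then none else some w)) := by
  unfold cyclePermanent
  -- The permutations are sorted by the image of `none`; the term `none` gives the fixed point with
  -- its extra factor `a`.
  rw [← Equiv.sum_comp Perm.decomposeOption.symm, Fintype.sum_prod_type, Fintype.sum_option]
  simp only [cycleCount_decomposeOption_none, cycleCount_decomposeOption_some,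
    Fintype.prod_option, decomposeOption_symm_some_apply_some]
  congr 1
  · rw [Finset.mul_sum]
    refine Finset.sum_congr rfl fun e _ => ?_
    simp
    ring
  · refine Finset.sum_congr rfl fun p _ => ?_
    rw [Finset.mul_sum]
    refine Finset.sum_congr rfl fun e _ => ?_
    simp
    ring

/-- If `σ k = p` with `p ≠ k`, contracting `k` leaves a permutation of `S` in which the arrow `v →
p` stands for `v → k → p`. The entry of row `v` is then taken from column `k`, hence the
substitution of `k` for `p`. This is the form that matches the annihilation operator. -/
theorem cyclePermanent_insert {α : Type*} [DecidableEq α] {S : Finset α} {k : α} (hk : k ∉ S) (a : ℂ)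
    (M : α → α → ℂ) :
    cyclePermanent a (fun v w : ↥(insert k S) => M v w) =
      a * M k k * cyclePermanent a (fun v w : S => M v w) +
      ∑ p ∈ S, M k p * cyclePermanent a (fun v w : S => M v (if (w : α) = p then k else w)) := by
  rw [← cyclePermanent_equiv (Finset.subtypeInsertEquivOption hk).symm, cyclePermanent_option,
    ← Finset.sum_coe_sort S]
  congr 1
  refine Finset.sum_congr rfl fun p _ => ?_
  congr 2
  ext v w
  by_cases h : w = p
  · simp [h, Finset.subtypeInsertEquivOption]
  · have h' : (w : α) ≠ p := fun h' => h (Subtype.ext h')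
    simp [h, h', Finset.subtypeInsertEquivOption]

theorem cyclePermanent_empty {α : Type*} [DecidableEq α] (a : ℂ) (M : α → α → ℂ) :
    cyclePermanent a (fun v w : (∅ : Finset α) => M v w) = 1 := by
  have hc : cycleCount (1 : Perm (∅ : Finset α)) = 0 := by
    unfold cycleCount
    rw [Nat.card_eq_zero]
    exact .inl ⟨fun q => Quotient.inductionOn q fun x => absurd x.2 (Finset.notMem_empty _)⟩
  unfold cyclePermanent
  rw [Fintype.sum_unique, show (default : Perm (∅ : Finset α)) = 1 from Subsingleton.elim _ _, hc]
  simp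

/-! ### Simple tensors indexed by lists. -/

section

variable {H : Type*} [NormedAddCommGroup H] [InnerProductSpace ℂ H] (N : ℤ) [NeZero N]

/-- The simple tensor with the given list of factors. -/
noncomputable def listTensor (l : List H) : AlgFock N H := tensor N l.length l.get

/-- Lists carry their length as data, so equal tensors of propositionally equal degrees become equal
terms without casts. -/
theorem tensor_eq_listTensor {n : ℕ} (x : Fin n → H) :
    tensor N n x = listTensor N (List.ofFn x) := by
  have : ∀ (m : ℕ) (y : Fin m → H) (h : n = m), (∀ j, y (Fin.cast h j) = x j) →
      tensor N n x = tensor N m y := by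
    rintro m y rfl h
    exact congrArg _ (funext fun j => (h j).symm)
  exact this _ _ (List.length_ofFn).symm fun j => by simp

theorem listTensor_nil : listTensor N ([] : List H) = vacuum N H :=
  congrArg (tensor N 0) (Subsingleton.elim _ _)

theorem create_listTensor (ξ : H) (l : List H) :
    create N ξ (listTensor N l) = listTensor N (ξ :: l) := by
  rw [listTensor, create_tensor, tensor_eq_listTensor, List.ofFn_cons, List.ofFn_get]

/-- Factors are addressed by distinct labels instead of positions, so that replacing a factor is an
update of the labelling `y`. The induction over prefixes can then absorb the replacement into its
arbitrary `y`. -/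
theorem annihilate_listTensor {α : Type*} [DecidableEq α] (ξ : H) (y : α → H) (k : α) (l : List α)
    (hl : l.Nodup) :
    annihilate N ξ (listTensor N ((k :: l).map y)) =
      inner ℂ ξ (y k) • listTensor N (l.map y) +
        (1 / (N : ℂ)) • ∑ p ∈ l.toFinset,
          inner ℂ ξ (y p) • listTensor N (l.map (Function.update y p (y k))) := by
  have h0 : listTensor N ((k :: l).map y) =
      tensor N (l.length + 1) (Fin.cons (y k) fun j => y (l.get j)) := by
    rw [tensor_eq_listTensor, List.ofFn_cons, List.map_cons]
    congr 2
    exact (List.ofFn_get l ▸ List.map_ofFn (f := l.get) (g := y) :)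
  have h1 : ∀ z : α → H, tensor N l.length (fun j => z (l.get j)) = listTensor N (l.map z) := by
    intro z
    rw [tensor_eq_listTensor]
    congr 1
    exact (List.ofFn_get l ▸ List.map_ofFn (f := l.get) (g := z) :).symm
  rw [h0, annihilate_tensor]
  simp only [Fin.cons_zero, Fin.tail_cons, h1]
  congr 2
  rw [List.sum_toFinset _ hl, ← Fin.sum_univ_fun_getElem]
  refine Finset.sum_congr rfl fun j _ => ?_
  simp only [List.get_eq_getElem]
  congr 1
  rw [← h1]
  congr 1
  ext1 j'
  rcases eq_or_ne j' j with rfl | h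
  · simp
  · rw [Function.update_of_ne h, Function.update_of_ne (a := l.get j')]
    · rfl
    -- Distinct labels ensure that an update at the label of position `j` leaves every other
    -- position alone.
    · exact fun h' => h (Fin.ext ((List.Nodup.getElem_inj_iff hl).1 h'))

theorem inner_vacuum_vacuum : inner ℂ (vacuum N H) (vacuum N H) = (1 : ℂ) := by
  have hc : cycleCount (1 : Perm (Fin 0)) = 0 := by
    unfold cycleCount
    rw [Nat.card_eq_zero]
    exact .inl ⟨fun q => Quotient.inductionOn q fun x => x.elim0⟩
  have h : inner ℂ (vacuum N H) (vacuum N H) =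
      inner ℂ (simple N (Fin.elim0 : Fin 0 → H)) (simple N (Fin.elim0 : Fin 0 → H)) := rfl
  rw [h, inner_simple, simpleForm_same, tensorForm, Fintype.sum_unique,
    show (default : Perm (Fin 0)) = 1 from Subsingleton.elim _ _, charN, hc]
  simp

end

/-! ### The open noncrossing pairs as a stack. -/

section

variable {m : ℕ} (S : Finset (Fin m))

/-- The elements of `S` before time `k`. -/
def before (k : ℕ) : Finset (Fin m) := S.filter fun a => (a : ℕ) < k

/-- The left points of the noncrossing pairs that are open at time `k`. -/
noncomputable def openPoints (k : ℕ) : Finset (Fin m) :=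
  (before S k).filter fun a => k ≤ (noncrossing S a : ℕ)

variable {S}

theorem before_succ_of_notMem {k : Fin m} (hk : k ∉ S) : before S (k + 1) = before S k := by
  ext a
  simp only [before, Finset.mem_filter, and_congr_right_iff]
  intro ha
  have : (a : ℕ) ≠ k := fun h => hk (Fin.ext h ▸ ha)
  omega

theorem before_succ_of_mem {k : Fin m} (hk : k ∈ S) :
    before S (k + 1) = insert k (before S k) := by
  ext a
  simp only [before, Finset.mem_filter, Finset.mem_insert, Fin.ext_iff]
  constructor
  · rintro ⟨h1, h2⟩
    rcases Nat.lt_succ_iff_lt_or_eq.1 h2 with h | h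
    · exact .inr ⟨h1, h⟩
    · exact .inl h
  · rintro (h | ⟨h1, h2⟩)
    · exact ⟨Fin.ext h ▸ hk, by omega⟩
    · exact ⟨h1, by omega⟩

theorem notMem_before (k : Fin m) : k ∉ before S k := by simp [before]

theorem lt_noncrossing_iff (hS : IsBallot S) (j : Fin m) : j < noncrossing S j ↔ j ∈ S := by
  conv_rhs => rw [← (noncrossing_spec hS).2.2]
  simp [leftPoints]

theorem mem_openPoints {k : ℕ} {a : Fin m} :
    a ∈ openPoints S k ↔ a ∈ S ∧ (a : ℕ) < k ∧ k ≤ (noncrossing S a : ℕ) := by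
  simp [openPoints, before, and_assoc]

/-- A left point opens the newest pair. Being the largest open left point, it heads the decreasing
list. -/
theorem sort_openPoints_succ_of_mem (hS : IsBallot S) {k : Fin m} (hk : k ∈ S) :
    (openPoints S (k + 1)).sort (· ≥ ·) = k :: (openPoints S k).sort (· ≥ ·) := by
  have h : openPoints S (k + 1) = insert k (openPoints S k) := by
    have hlt := (lt_noncrossing_iff hS k).2 hk
    ext a
    rw [Finset.mem_insert, mem_openPoints, mem_openPoints]
    rcases eq_or_ne a k with rfl | hak
    · simp only [hk, true_and, true_or, iff_true]
      rw [Fin.lt_def] at hlt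
      omega
    · have h1 : (a : ℕ) ≠ k := fun h => hak (Fin.ext h)
      -- No pair closes at `k`, since `k` is itself a left point.
      have h2 : a ∈ S → (noncrossing S a : ℕ) ≠ k := by
        intro ha h
        have := (lt_noncrossing_iff hS (noncrossing S a)).2 (by rw [Fin.ext h]; exact hk)
        rw [((noncrossing_spec hS).1 a).2] at this
        exact absurd this ((lt_noncrossing_iff hS a).2 ha).asymm
      simp only [hak, false_or]
      constructor
      · rintro ⟨ha, h3, h4⟩
        exact ⟨ha, by omega, by omega⟩
      · rintro ⟨ha, h3, h4⟩
        exact ⟨ha, by omega, by have := h2 ha; omega⟩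
  rw [h, Finset.sort_insert]
  · intro a ha
    exact Fin.le_def.2 (mem_openPoints.1 ha).2.1.le
  · simp [mem_openPoints]

/-- A right point closes the most recently opened pair. This is where noncrossing is used. -/
theorem sort_openPoints_of_notMem (hS : IsBallot S) {k : Fin m} (hk : k ∉ S) :
    (openPoints S k).sort (· ≥ ·) =
      noncrossing S k :: (openPoints S (k + 1)).sort (· ≥ ·) := by
  obtain ⟨hp, hn, -⟩ := noncrossing_spec hS
  have hkS : noncrossing S k ∈ S := by
    rw [← lt_noncrossing_iff hS, (hp k).2]
    exact lt_of_le_of_ne (not_lt.1 fun h => hk ((lt_noncrossing_iff hS k).1 h)) (hp k).1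
  have hlt := (lt_noncrossing_iff hS _).2 hkS
  rw [(hp k).2] at hlt
  have h : openPoints S k = insert (noncrossing S k) (openPoints S (k + 1)) := by
    ext a
    rw [Finset.mem_insert, mem_openPoints, mem_openPoints]
    rcases eq_or_ne a (noncrossing S k) with rfl | hak
    · simp only [hkS, true_and, true_or, iff_true, (hp k).2]
      exact ⟨hlt, le_rfl⟩
    · have h1 : (noncrossing S a : ℕ) ≠ k := by
        intro h
        rw [← Fin.ext h, (hp a).2] at hak
        exact hak rfl
      simp only [hak, false_or, and_congr_right_iff]
      intro ha
      have h2 : (a : ℕ) ≠ k := fun h => hk (Fin.ext h ▸ ha)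
      omega
  rw [h, Finset.sort_insert]
  · intro a ha
    obtain ⟨-, h1, h2⟩ := mem_openPoints.1 ha
    by_contra hc
    have hak : a ≠ k := by
      rintro rfl
      exact hk (mem_openPoints.1 ha).1
    -- Otherwise a pair opened at `a`, after the partner of `k`, would outlast `k` and cross the
    -- pair closed at `k`.
    refine hn (noncrossing S k) a (not_le.1 hc) ?_ ?_
    · rw [(hp k).2]
      exact lt_of_le_of_ne (Fin.le_def.2 (Nat.lt_succ_iff.1 h1)) hak
    · rw [(hp k).2, Fin.lt_def]
      omega
  · rw [mem_openPoints, (hp k).2]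
    omega

end

/-! ### The vacuum expectation as a cycle permanent. -/

/-- The vectors `y` on open labels stay arbitrary because an annihilator moves its first factor into
another open slot. On closed labels `y` must already be the vector of the creator closing the pair;
those columns keep the order constraint, which for open columns holds automatically. The power of
`N` clears one factor `1/N` per annihilator. -/
theorem vacuum_prefix_eq_cyclePermanent (N : ℤ) [NeZero N] {H : Type*} [NormedAddCommGroup H]
    [InnerProductSpace ℂ H] {m : ℕ} (ε : Fin m → Exponent) (hS : IsBallot (annihilators ε))
    (ξ : Fin m → H) (k : ℕ) (hk : k ≤ m) (y : Fin m → H)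
    (hy : ∀ a ∈ annihilators ε, (noncrossing (annihilators ε) a : ℕ) < k →
      y a = ξ (noncrossing (annihilators ε) a)) :
    (N : ℂ) ^ (before (annihilators ε) k).card *
      inner ℂ (vacuum N H) (((List.ofFn fun j => letter N (ε j) (ξ j)).take k).prod
        (listTensor N (((openPoints (annihilators ε) k).sort (· ≥ ·)).map y))) =
      cyclePermanent (N : ℂ) fun v w : before (annihilators ε) k =>
        if (v : Fin m) < noncrossing (annihilators ε) w then (inner ℂ (ξ v) (y w) : ℂ) else 0 := by
  have hN : (N : ℂ) ≠ 0 := by exact_mod_cast NeZero.ne N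
  have hmem : ∀ j, j ∈ annihilators ε ↔ ε j = .star := by intro j; simp [annihilators]
  generalize hSA : annihilators ε = S at *
  induction k generalizing y with
  | zero =>
    have h1 : before S 0 = ∅ := by simp [before]
    have h2 : openPoints S 0 = ∅ := by simp [openPoints, h1]
    rw [h1, h2, cyclePermanent_empty (N : ℂ) (fun v w : Fin m =>
      if v < noncrossing S w then (inner ℂ (ξ v) (y w) : ℂ) else 0)]
    rw [Finset.sort_empty, List.map_nil, listTensor_nil]
    simpa using inner_vacuum_vacuum N
  | succ k ih =>
    obtain ⟨κ, rfl⟩ : ∃ κ : Fin m, (κ : ℕ) = k := ⟨⟨k, hk⟩, rfl⟩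
    have hprod : ((List.ofFn fun j => letter N (ε j) (ξ j)).take (κ + 1)).prod =
        ((List.ofFn fun j => letter N (ε j) (ξ j)).take κ).prod * letter N (ε κ) (ξ κ) := by
      rw [List.prod_take_succ _ _ (by simp)]
      simp
    rw [hprod, Module.End.mul_apply]
    have hbb := ((noncrossing_spec hS).1 κ).2
    by_cases hκ : κ ∈ S
    · have hy' : ∀ p ∈ openPoints S κ, ∀ a ∈ S, (noncrossing S a : ℕ) < κ →
          Function.update y p (y κ) a = ξ (noncrossing S a) := by
        intro p hp a ha hak
        rw [Function.update_of_ne, hy a ha (by omega)]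
        rintro rfl
        exact absurd (mem_openPoints.1 hp).2.2 (by omega)
      have ih0 := ih κ.2.le y fun a ha h => hy a ha (by omega)
      have ihp := fun p hp => ih κ.2.le (Function.update y p (y κ)) (hy' p hp)
      rw [(hmem κ).1 hκ, show letter N .star (ξ κ) = annihilate N (ξ κ) from rfl,
        sort_openPoints_succ_of_mem hS hκ, annihilate_listTensor _ _ _ _ _ (Finset.sort_nodup _ _),
        Finset.sort_toFinset, before_succ_of_mem hκ,
        cyclePermanent_insert (notMem_before κ) (N : ℂ) (fun v w : Fin m =>
          if v < noncrossing S w then (inner ℂ (ξ v) (y w) : ℂ) else 0), ← ih0,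
        Finset.card_insert_of_notMem (notMem_before κ),
        if_pos ((lt_noncrossing_iff hS κ).2 hκ)]
      simp only [map_add, map_smul, map_sum, inner_add_right, inner_smul_right, inner_sum, mul_add]
      -- The additional power of `N` weights the fixed point in the first term and cancels the `1/N`
      -- of the swaps in the second.
      congr 1
      · ring
      · rw [Finset.mul_sum, Finset.mul_sum]
        -- The operator sums over open labels, the row expansion over all earlier ones. A closed `p`
        -- has its partner to the left of `κ`, so the entry in row `κ` vanishes.
        refine Finset.sum_subset_zero_on_sdiff (Finset.filter_subset _ _) ?_ ?_
        · intro p hp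
          rw [Finset.mem_sdiff] at hp
          rw [if_neg, zero_mul]
          intro hlt
          refine hp.2 (Finset.mem_filter.2 ⟨hp.1, ?_⟩)
          exact (Fin.lt_def.1 hlt).le
        · intro p hp
          obtain ⟨hpS, hp1, hp2⟩ := mem_openPoints.1 hp
          have hne : noncrossing S p ≠ κ := by
            intro h
            rw [← h, ← lt_noncrossing_iff hS, ((noncrossing_spec hS).1 p).2] at hκ
            exact absurd hκ ((lt_noncrossing_iff hS p).2 hpS).asymm
          have hlt : κ < noncrossing S p := lt_of_le_of_ne (Fin.le_def.2 hp2) hne.symm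
          -- All remaining rows lie before `κ`, while the partners of `κ` and of the open label `p`
          -- both lie after `κ`. The order condition holds in either column, so substituting `κ` for
          -- `p` changes only the vector.
          have hM : (fun v w : before S κ =>
              if (v : Fin m) < noncrossing S (if (w : Fin m) = p then κ else w) then
                (inner ℂ (ξ v) (y (if (w : Fin m) = p then κ else w)) : ℂ) else 0) =
              fun v w : before S κ => if (v : Fin m) < noncrossing S w then
                (inner ℂ (ξ v) (Function.update y p (y κ) w) : ℂ) else 0 := by
            ext v w
            have hv : (v : Fin m) < κ := Fin.lt_def.2 (Finset.mem_filter.1 v.2).2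
            by_cases hw : (w : Fin m) = p
            · simp only [hw, if_true, Function.update_self]
              rw [if_pos (hv.trans ((lt_noncrossing_iff hS κ).2 hκ)), if_pos (hv.trans hlt)]
            · simp [hw]
          rw [hM, ← ihp p hp, if_pos hlt]
          field_simp
          ring
    · have hε : ε κ = .one := by
        rw [hmem] at hκ
        cases h : ε κ with
        | star => exact absurd h hκ
        | one => rfl
      have hκS : noncrossing S κ ∈ S := by
        rw [← lt_noncrossing_iff hS, hbb]
        exact lt_of_le_of_ne (not_lt.1 fun h => hκ ((lt_noncrossing_iff hS κ).1 h))
          ((noncrossing_spec hS).1 κ).1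
      -- The pair closed at `κ` is already covered by the hypothesis for `κ + 1`, so its label
      -- carries `ξ κ`, the vector that the creator prepends.
      have hyκ := hy _ hκS (by rw [hbb]; omega)
      rw [hbb] at hyκ
      have ih0 := ih κ.2.le y fun a ha h => hy a ha (by omega)
      rw [sort_openPoints_of_notMem hS hκ, List.map_cons, hyκ] at ih0
      rw [hε, show letter N .one (ξ κ) = create N (ξ κ) from rfl, create_listTensor, before_succ_of_notMem hκ]
      exact ih0

/-- For the full prefix every pair is closed: the tensor is the vacuum and `y` is forced on all
columns. -/
theorem vacuumState_word_eq_cyclePermanent (N : ℤ) [NeZero N] {H : Type*} [NormedAddCommGroup H]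
    [InnerProductSpace ℂ H] {m : ℕ} (ε : Fin m → Exponent) (hS : IsBallot (annihilators ε))
    (ξ : Fin m → H) :
    vacuumState N (word N ε ξ) = 1 / (N : ℂ) ^ (annihilators ε).card *
      cyclePermanent (N : ℂ) fun v w : annihilators ε =>
        if (v : Fin m) < noncrossing (annihilators ε) w then
          (inner ℂ (ξ v) (ξ (noncrossing (annihilators ε) w)) : ℂ) else 0 := by
  have hN : (N : ℂ) ≠ 0 := by exact_mod_cast NeZero.ne N
  have h := vacuum_prefix_eq_cyclePermanent N ε hS ξ m le_rfl
    (fun a => ξ (noncrossing (annihilators ε) a)) fun a _ _ => rfl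
  have h1 : before (annihilators ε) m = annihilators ε :=
    Finset.filter_true_of_mem fun a _ => a.2
  have h2 : openPoints (annihilators ε) m = ∅ :=
    Finset.filter_false_of_mem fun a _ => not_le.2 (noncrossing (annihilators ε) a).2
  rw [h1, h2, Finset.sort_empty, List.map_nil, listTensor_nil, List.take_of_length_le (by simp)] at h
  rw [← h, vacuumState, UniformSpace.Completion.inner_coe, word]
  field_simp

/-! ### Pair partitions as permutations of the left points. -/

open scoped Classical

theorem eq_of_leftPoints {m : ℕ} {π ρ : Perm (Fin m)} (hp : IsPairPartition π)
    (hp' : IsPairPartition ρ) (h : ∀ l ∈ leftPoints π, ρ l = π l) : ρ = π := by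
  ext1 j
  by_cases hj : j ∈ leftPoints π
  · exact h j hj
  · have h2 : π j ∈ leftPoints π := by
      simp only [leftPoints, Finset.mem_filter, Finset.mem_univ, true_and, (hp j).2, not_lt] at hj ⊢
      exact lt_of_le_of_ne hj (hp j).1
    have h3 := h _ h2
    rw [(hp j).2] at h3
    rw [← (hp' (π j)).2, h3]

theorem apply_mem_leftPoints_iff {m : ℕ} {π : Perm (Fin m)} (hp : IsPairPartition π) (j : Fin m) :
    π j ∈ leftPoints π ↔ j ∉ leftPoints π := by
  simp only [leftPoints, Finset.mem_filter, Finset.mem_univ, true_and, (hp j).2, not_lt]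
  exact ⟨le_of_lt, fun h => lt_of_le_of_ne h (hp j).1⟩

/-- Cancelling the noncrossing involution turns "is followed by" into `l = σ l'`, and the
equivalence relation generated by that is `σ.SameCycle`. -/
theorem pairCycleCount_eq {m : ℕ} {S : Finset (Fin m)} {π : Perm (Fin m)} (hS : leftPoints π = S)
    (σ : Perm S) (h : ∀ l : S, π l = noncrossing S (σ l)) : pairCycleCount π = cycleCount σ := by
  subst hS
  have hr : ∀ l l' : leftPoints π, noncrossing (leftPoints π) l = π l' ↔ l = σ l' := by
    intro l l'
    rw [h, (noncrossing (leftPoints π)).injective.eq_iff, Subtype.ext_iff]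
  -- `SameCycle` allows integer powers, so the class has to be followed along `σ` in both
  -- directions.
  have hz : ∀ (k : ℤ) (x : leftPoints π),
      Quot.mk (fun l l' : leftPoints π => noncrossing (leftPoints π) l = π l') ((σ ^ k) x) =
        Quot.mk _ x := by
    intro k
    induction k with
    | zero => intro x; simp
    | succ i ih =>
      intro x
      rw [zpow_add_one, Perm.mul_apply, ih]
      exact Quot.sound ((hr _ _).2 rfl)
    | pred i ih =>
      intro x
      rw [zpow_sub_one, Perm.mul_apply, ih]
      refine (Quot.sound ?_).symm
      exact (hr _ _).2 (σ.apply_symm_apply x).symm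
  refine Nat.card_congr
    { toFun := Quot.lift (fun l => Quotient.mk (Perm.SameCycle.setoid σ) l) fun l l' hl => ?_
      invFun := Quotient.lift (fun l => Quot.mk _ l) fun l l' hl => ?_
      left_inv := fun q => ?_
      right_inv := fun q => ?_ }
  · rw [(hr l l').1 hl]
    exact Quotient.sound (Perm.sameCycle_apply_left.2 (Perm.SameCycle.refl σ l'))
  · obtain ⟨k, rfl⟩ : σ.SameCycle l l' := hl
    exact (hz k l).symm
  · induction q using Quot.ind with
    | mk l => rfl
  · induction q using Quotient.inductionOn with
    | h l => rfl

/-- The pair partition with set of left points `S` that pairs `p` with the noncrossing partner of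
`σ p`, provided that this partner is to the right of `p`. -/
noncomputable def reconnect {m : ℕ} {S : Finset (Fin m)} (σ : Perm S) : Perm (Fin m) :=
  (Perm.ofSubtype σ)⁻¹ * noncrossing S * Perm.ofSubtype σ

section

variable {m : ℕ} {S : Finset (Fin m)}

/-- A conjugate of a fixed-point-free involution is again one, for every `σ`; the order condition
matters only for the left points. -/
theorem isPairPartition_reconnect (hS : IsBallot S) (σ : Perm S) :
    IsPairPartition (reconnect σ) := by
  intro j
  obtain ⟨h1, h2⟩ := (noncrossing_spec hS).1 (Perm.ofSubtype σ j)
  constructor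
  · intro h
    rw [reconnect, Perm.mul_apply, Perm.mul_apply, Perm.inv_eq_iff_eq] at h
    exact h1 h
  · simp [reconnect, h2]

theorem noncrossing_mem_iff (hS : IsBallot S) (j : Fin m) : noncrossing S j ∈ S ↔ j ∉ S := by
  have := apply_mem_leftPoints_iff (noncrossing_spec hS).1 j
  rwa [(noncrossing_spec hS).2.2] at this

/-- The noncrossing partner of `σ l` lies outside `S`, where the extension of `σ` is the identity,
so the outer conjugating factor has no effect. -/
theorem reconnect_apply (hS : IsBallot S) (σ : Perm S) (l : S) :
    reconnect σ l = noncrossing S (σ l) := by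
  rw [reconnect, Perm.mul_apply, Perm.mul_apply, Perm.inv_eq_iff_eq, Perm.ofSubtype_apply_coe,
    Perm.ofSubtype_apply_of_not_mem]
  rw [noncrossing_mem_iff hS]
  exact not_not.2 (σ l).2

theorem leftPoints_reconnect (hS : IsBallot S) (σ : Perm S)
    (h : ∀ l : S, (l : Fin m) < noncrossing S (σ l)) : leftPoints (reconnect σ) = S := by
  have hsub : ∀ l ∈ S, l ∈ leftPoints (reconnect σ) := by
    intro l hl
    simpa [leftPoints, reconnect_apply hS σ ⟨l, hl⟩] using h ⟨l, hl⟩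
  have hp := isPairPartition_reconnect hS σ
  ext j
  refine ⟨fun hj => ?_, hsub j⟩
  by_contra hjS
  -- A point outside `S` is the partner of some element of `S`, which is a left point, so it cannot
  -- be one itself.
  refine (apply_mem_leftPoints_iff hp j).1 (hsub _ ?_) hj
  have h1 : noncrossing S j ∈ S := (noncrossing_mem_iff hS j).2 hjS
  have h2 : reconnect σ (σ⁻¹ ⟨_, h1⟩ : S) = j := by
    rw [reconnect_apply hS]
    simp [((noncrossing_spec hS).1 j).2]
  rw [← h2, (hp _).2]
  exact (σ⁻¹ _).2

theorem reconnect_injective (hS : IsBallot S) :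
    Function.Injective (reconnect : Perm S → Perm (Fin m)) := by
  intro σ τ h
  ext1 l
  have := reconnect_apply hS σ l
  rw [h, reconnect_apply hS] at this
  exact Subtype.ext ((noncrossing S).injective this.symm)

/-- Both `π` and the noncrossing involution exchange `S` with its complement, so their composite
restricts to a permutation of `S`; this is the required `σ`. -/
theorem exists_reconnect_eq (hS : IsBallot S) {π : Perm (Fin m)} (hp : IsPairPartition π)
    (hl : leftPoints π = S) : ∃ σ : Perm S, reconnect σ = π := by
  have h1 : ∀ j, (noncrossing S * π) j ∈ S ↔ j ∈ S := by
    intro j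
    have := apply_mem_leftPoints_iff hp j
    rw [hl] at this
    rw [Perm.mul_apply, noncrossing_mem_iff hS, this, not_not]
  refine ⟨(noncrossing S * π).subtypePerm h1, ?_⟩
  refine eq_of_leftPoints hp (isPairPartition_reconnect hS _) fun l hlm => ?_
  rw [hl] at hlm
  rw [reconnect_apply hS _ ⟨l, hlm⟩]
  simp [((noncrossing_spec hS).1 _).2]

end

theorem pairPartitionState_tN_eq_cyclePermanent (N : ℤ) [NeZero N] {H : Type*} [NormedAddCommGroup H]
    [InnerProductSpace ℂ H] {m : ℕ} (ε : Fin m → Exponent) (hS : IsBallot (annihilators ε))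
    (ξ : Fin m → H) :
    pairPartitionState (tN N) ε ξ = 1 / (N : ℂ) ^ (annihilators ε).card *
      cyclePermanent (N : ℂ) fun v w : annihilators ε =>
        if (v : Fin m) < noncrossing (annihilators ε) w then
          (inner ℂ (ξ v) (ξ (noncrossing (annihilators ε) w)) : ℂ) else 0 := by
  have hN : (N : ℂ) ≠ 0 := by exact_mod_cast NeZero.ne N
  set S := annihilators ε with hSdef
  have hmem : ∀ j, j ∈ S ↔ ε j = .star := by intro j; simp [hSdef, annihilators]
  have hone : ∀ j, j ∉ S → ε j = .one := by
    intro j hj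
    rw [hmem] at hj
    cases h : ε j with
    | star => exact absurd h hj
    | one => rfl
  -- A permutation that sends some `l` to a vertex whose noncrossing partner is not to the right of
  -- `l` contributes a zero entry.
  have hzero : ∀ σ ∈ (Finset.univ : Finset (Perm S)),
      σ ∉ (Finset.univ.filter fun σ : Perm S => ∀ l : S, (l : Fin m) < noncrossing S (σ l)) →
      ((N : ℂ) ^ cycleCount σ * ∏ p : S, if (p : Fin m) < noncrossing S (σ p) then
          (inner ℂ (ξ p) (ξ (noncrossing S (σ p))) : ℂ) else 0) = 0 := by
    intro σ _ h
    simp only [Finset.mem_filter, Finset.mem_univ, true_and, not_forall] at h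
    obtain ⟨l, hl⟩ := h
    rw [Finset.prod_eq_zero (Finset.mem_univ l) (if_neg hl), mul_zero]
  rw [cyclePermanent, ← Finset.sum_subset (Finset.filter_subset _ _) hzero, Finset.mul_sum]
  symm
  unfold pairPartitionState
  refine Finset.sum_of_injOn reconnect (reconnect_injective hS).injOn ?_ ?_ ?_
  · intro σ _
    simpa using isPairPartition_reconnect hS σ
  · intro π hπ hni
    simp only [Finset.mem_filter, Finset.mem_univ, true_and] at hπ
    by_contra hne
    have hQ : ∀ k ∈ leftPoints π, Q (ε k) (ε (π k)) ≠ 0 := fun k hk h0 =>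
      hne (by rw [Finset.prod_eq_zero hk (by rw [h0, zero_mul]), mul_zero])
    have hQ' : ∀ k ∈ leftPoints π, ε k = .star ∧ ε (π k) = .one := by
      intro k hk
      have := hQ k hk
      revert this
      cases ε k <;> cases ε (π k) <;> simp [Q]
    have hl : leftPoints π = S := by
      -- An annihilator that is not a left point would be the right end of a pair, where `Q` demands
      -- a creator.
      ext j
      refine ⟨fun hj => (hmem j).2 (hQ' j hj).1, fun hj => ?_⟩
      by_contra hjl
      have := (hQ' _ ((apply_mem_leftPoints_iff hπ j).2 hjl)).2
      rw [(hπ j).2, (hmem j).1 hj] at this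
      cases this
    obtain ⟨σ, rfl⟩ := exists_reconnect_eq hS hπ hl
    refine hni ⟨σ, ?_, rfl⟩
    simp only [Finset.coe_filter, Finset.mem_univ, true_and, Set.mem_ofPred_eq]
    intro l
    rw [← reconnect_apply hS]
    have hl' : (l : Fin m) ∈ leftPoints (reconnect σ) := by rw [hl]; exact l.2
    simpa [leftPoints] using hl'
  · intro σ hσ
    simp only [Finset.mem_filter, Finset.mem_univ, true_and] at hσ
    have hl := leftPoints_reconnect hS σ hσ
    rw [tN, pairCycleCount_eq hl σ (reconnect_apply hS σ), hl, ← mul_assoc]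
    congr 1
    -- The exponent `|π| - c(π)` splits: the pairs give the common prefactor, the cycles give `N ^
    -- c(σ)`.
    · rw [one_div (N : ℂ), inv_zpow', neg_sub, zpow_sub₀ hN, zpow_natCast, zpow_natCast]
      ring
    · rw [← Finset.prod_coe_sort S]
      refine Finset.prod_congr rfl fun p _ => ?_
      rw [if_pos (hσ p), reconnect_apply hS, (hmem p).1 p.2, hone]
      · simp [Q]
      · rw [noncrossing_mem_iff hS]
        exact not_not.2 (σ p).2

/-! ### From cycle permanents to cycle cover polynomials. -/

theorem card_annihilators {n : ℕ} {ε : Fin (2 * n) → Exponent} (hS : IsBallot (annihilators ε)) :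
    (annihilators ε).card = n := by
  have h1 := card_eq_of_ballot hS
  have h2 := Finset.card_add_card_compl (annihilators ε)
  rw [Fintype.card_fin] at h2
  omega

/-- For a 0-1 matrix the product along `σ` is the indicator that every arrow `v → σ v` belongs to
`Γ`. -/
theorem cyclePermanent_eq_cycleCoverPolynomial {V : Type*} [Fintype V] [DecidableEq V]
    (Γ : Digraph V) (N : ℤ) (M : V → V → ℂ) (h1 : ∀ v w, Γ.Adj v w → M v w = 1)
    (h0 : ∀ v w, ¬ Γ.Adj v w → M v w = 0) :
    cyclePermanent (N : ℂ) M = (((cycleCoverPolynomial Γ).eval N : ℤ) : ℂ) := by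
  rw [cyclePermanent, cycleCoverPolynomial, Polynomial.eval_finsetSum, Finset.sum_filter,
    Int.cast_sum]
  -- The two sums range over `Perm V` with possibly different decidability instances, which `congr!`
  -- identifies.
  refine Finset.sum_congr (by congr!) fun σ _ => ?_
  split_ifs with h
  · rw [Finset.prod_eq_one fun v _ => h1 _ _ (h v)]
    simp
  · obtain ⟨v, hv⟩ := not_forall.1 h
    rw [Finset.prod_eq_zero (Finset.mem_univ v) (h0 v (σ v) hv)]
    simp

end CharFock

theorem mainTheorem9 (N : ℤ) [NeZero N]
    {H : Type*} [NormedAddCommGroup H] [InnerProductSpace ℂ H]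
    {ι : Type*} (e : ι → H) (he : Orthonormal ℂ e)
    (n : ℕ) (i : Fin (2 * n) → ι) (ε : Fin (2 * n) → CharFock.Exponent)
    (hW : CharFock.IsDyckWord i ε) :
    CharFock.vacuumState N (CharFock.word N ε fun j => e (i j)) =
        1 / (N : ℂ) ^ n *
          (((CharFock.cycleCoverPolynomial (CharFock.wordDigraph i ε)).eval N : ℤ) : ℂ) ∧
      CharFock.pairPartitionState (CharFock.tN N) ε (fun j => e (i j)) =
        1 / (N : ℂ) ^ n *
          (((CharFock.cycleCoverPolynomial (CharFock.wordDigraph i ε)).eval N : ℤ) : ℂ) := by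
  -- The Dyck condition enters only through its sum over the colours, which makes the annihilators
  -- the left points of a noncrossing pair partition.
  have hS := CharFock.isBallot_annihilators hW
  have key := CharFock.cyclePermanent_eq_cycleCoverPolynomial (CharFock.wordDigraph i ε) N
    (fun v w => if (v : Fin (2 * n)) < CharFock.noncrossing (CharFock.annihilators ε) w then
      inner ℂ (e (i v)) (e (i (CharFock.noncrossing (CharFock.annihilators ε) w))) else 0)
    (fun v w h => by rw [if_pos h.2, h.1, inner_self_eq_norm_sq_to_K, he.1]; simp)
    (fun v w h => by
      split_ifs with hlt
      -- The order condition holds but there is no arrow, so the colours differ and the vectors are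
      -- orthogonal.
      · exact he.2 fun hi => h ⟨hi, hlt⟩
      · rfl)
  constructor
  · rw [CharFock.vacuumState_word_eq_cyclePermanent N ε hS, CharFock.card_annihilators hS, key]
  · rw [CharFock.pairPartitionState_tN_eq_cyclePermanent N ε hS, CharFock.card_annihilators hS, key]
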